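/- A spacetime is a connected, Hausdorff, second countable smooth manifold $M$ without boundary, of dimension $n+1$, with a Lorentzian metric $g$ of signature $(-,+,\dots,+)$ (of any class $C^k$, $0\le k\le\infty$) and a time orientation, given by a continuous timelike vector field. A Cauchy hypersurface is a subset $H\subset M$ that every inextendible future directed (piecewise $C^1$) timelike curve meets exactly once. A spacelike hypersurface is a non-empty embedded $C^1$ submanifold of $M$ of codimension one, without boundary, on whose tangent spaces $g$ is positive definite. A spacetime is called (spatially) open if it contains no compact spacelike hypersurface. **Proposition.** Every spacetime that admits a non-compact Cauchy hypersurface is (spatially) open. -/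

import Mathlib

open Set Filter Topology
open scoped Manifold ContDiff Bundle

noncomputable section

section Spacetimes

variable (n : ℕ) (k : ℕ∞) (M : Type*) [TopologicalSpace M]
  [ChartedSpace (EuclideanSpace ℝ (Fin (n + 1))) M] [IsManifold (𝓡 (n + 1)) ∞ M]

/-- A Lorentzian metric of class `C^k` on the smooth `(n+1)`-dimensional manifold `M`, with signature
`(-, +, ..., +)`. The last field is Sylvester's form of the signature condition: there is a vector
of negative square whose orthogonal complement is positive definite. -/
structure LorentzianMetric where
  /-- The scalar product on the tangent spaces. -/
  val (x : M) : TangentSpace (𝓡 (n + 1)) x →L[ℝ] TangentSpace (𝓡 (n + 1)) x →L[ℝ] ℝ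
  symm (x : M) (v w : TangentSpace (𝓡 (n + 1)) x) : val x v w = val x w v
  contMDiff : ContMDiff (𝓡 (n + 1))
    ((𝓡 (n + 1)).prod 𝓘(ℝ, EuclideanSpace ℝ (Fin (n + 1)) →L[ℝ]
      EuclideanSpace ℝ (Fin (n + 1)) →L[ℝ] ℝ)) (k : WithTop ℕ∞)
    (fun x ↦ Bundle.TotalSpace.mk' (EuclideanSpace ℝ (Fin (n + 1)) →L[ℝ]
      EuclideanSpace ℝ (Fin (n + 1)) →L[ℝ] ℝ) x (val x))
  signature (x : M) : ∃ v : TangentSpace (𝓡 (n + 1)) x, val x v v < 0 ∧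
    ∀ w : TangentSpace (𝓡 (n + 1)) x, w ≠ 0 → val x v w = 0 → 0 < val x w w

variable {n k M}

/-- A time orientation, given by a continuous timelike vector field, declared future directed. -/
structure TimeOrientation (g : LorentzianMetric n k M) where
  /-- The vector field. -/
  field (x : M) : TangentSpace (𝓡 (n + 1)) x
  continuous : Continuous
    (fun x ↦ (Bundle.TotalSpace.mk x (field x) : TangentBundle (𝓡 (n + 1)) M))
  timelike (x : M) : g.val x (field x) (field x) < 0

/-- `v` is timelike and lies in the same half of the timelike cone as the time orientation. -/
def IsFutureTimelike (g : LorentzianMetric n k M) (T : TimeOrientation g) (x : M)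
    (v : TangentSpace (𝓡 (n + 1)) x) : Prop :=
  g.val x v v < 0 ∧ g.val x (T.field x) v < 0

/-- On the compact interval `[a, b]` the curve `γ` is `C^1` up to the end points, with future
directed timelike velocity everywhere (one-sided at the end points). -/
def IsFutureTimelikeOnIcc (g : LorentzianMetric n k M) (T : TimeOrientation g)
    (γ : ℝ → M) (a b : ℝ) : Prop :=
  ContMDiffOn 𝓘(ℝ, ℝ) (𝓡 (n + 1)) 1 γ (Icc a b) ∧
    ∀ s ∈ Icc a b, IsFutureTimelike g T (γ s)
      (mfderivWithin 𝓘(ℝ, ℝ) (𝓡 (n + 1)) γ (Icc a b) s (1 : ℝ))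

/-- A future directed piecewise `C^1` timelike curve, defined on the open interval `J`. Every
parameter has a one-sided compact neighbourhood to its left and one to its right on which the
curve is `C^1` and future directed timelike; equivalently, `J` is divided by a locally finite set
of break points into intervals on which `γ` is of this kind, and `γ` is continuous. -/
structure IsTimelikeCurve (g : LorentzianMetric n k M) (T : TimeOrientation g)
    (γ : ℝ → M) (J : Set ℝ) : Prop where
  isOpen : IsOpen J
  ordConnected : J.OrdConnected
  nonempty : J.Nonempty
  piecewise : ∀ t ∈ J, ∃ ε : ℝ, 0 < ε ∧ Icc (t - ε) (t + ε) ⊆ J ∧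
    IsFutureTimelikeOnIcc g T γ (t - ε) t ∧ IsFutureTimelikeOnIcc g T γ t (t + ε)

/-- The curve `γ` on the open interval `J` is inextendible: it has no future and no past end
point, that is, `γ t` has no limit in `M` as `t` tends to the right or to the left end of `J`. -/
def IsInextendible (γ : ℝ → M) (J : Set ℝ) : Prop :=
  (∀ p : M, ¬ Tendsto (fun t : J ↦ γ t) atTop (𝓝 p)) ∧
    ∀ p : M, ¬ Tendsto (fun t : J ↦ γ t) atBot (𝓝 p)

/-- A Cauchy hypersurface: a subset of the spacetime that every inextendible timelike curve meets
exactly once. -/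
def IsCauchyHypersurface (g : LorentzianMetric n k M) (T : TimeOrientation g)
    (H : Set M) : Prop :=
  ∀ (γ : ℝ → M) (J : Set ℝ), IsTimelikeCurve g T γ J → IsInextendible γ J →
    ∃! t : ℝ, t ∈ J ∧ γ t ∈ H

variable (n) in
/-- `f` is a `C^1` function on the open set `U` without critical points, and `S ∩ U` is its zero
level. The tangent space of `S` at a point of `S ∩ U` is then the kernel of the differential of
`f`. -/
structure IsLocalDefiningFunction (S U : Set M) (f : M → ℝ) : Prop where
  isOpen : IsOpen U
  contMDiffOn : ContMDiffOn (𝓡 (n + 1)) 𝓘(ℝ, ℝ) 1 f U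
  regular : ∀ x ∈ U, mfderiv (𝓡 (n + 1)) 𝓘(ℝ, ℝ) f x ≠ 0
  inter_eq : S ∩ U = {x ∈ U | f x = 0}

/-- A spacelike hypersurface: a non-empty embedded `C^1` submanifold of codimension one, without
boundary, on whose tangent spaces the metric is positive definite. -/
structure IsSpacelikeHypersurface (g : LorentzianMetric n k M) (S : Set M) : Prop where
  nonempty : S.Nonempty
  isHypersurface : ∀ x ∈ S, ∃ (U : Set M) (f : M → ℝ), x ∈ U ∧ IsLocalDefiningFunction n S U f
  isSpacelike : ∀ (U : Set M) (f : M → ℝ), IsLocalDefiningFunction n S U f →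
    ∀ x ∈ S ∩ U, ∀ w : TangentSpace (𝓡 (n + 1)) x, w ≠ 0 →
      mfderiv (𝓡 (n + 1)) 𝓘(ℝ, ℝ) f x w = 0 → 0 < g.val x w w

/-- A spacetime is (spatially) open if it contains no compact spacelike hypersurface. -/
def IsSpatiallyOpen (g : LorentzianMetric n k M) : Prop :=
  ¬ ∃ S : Set M, IsCompact S ∧ IsSpacelikeHypersurface g S

end Spacetimes

end

/-!
Let `H` be a non-compact Cauchy hypersurface and suppose that `S` is a compact spacelike
hypersurface. Convexity of the future cones and a partition of unity give a future timelike vector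
field `X` of class `C^1` (`exists_contMDiff_isFutureTimelike`). Its maximal integral curves are inextendible
timelike curves (`isInextendible_flow`), so that each of them meets `H` exactly once. This defines a
projection `ρ : M → H` along the flow of `X`.

The projection is continuous (`IsCauchyHypersurface.exists_continuous_projection`). At a point `h`
of `H` this holds since a point near the flow line of `h`, slightly to the future of `h`, can be
joined to the past half of that line by a short timelike segment. The broken curve so obtained
already meets `H` at `h`, so that the flow line of the nearby point does not meet `H` in its future.
Together with the time-reversed statement, this bounds the time after which nearby flow lines meet
`H`. The local continuity of the flow transports continuity from `H` along the flow lines to all of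
`M` (`mem_nhds_of_mem_nhds_flow`).

The set `A = ρ⁻¹(ρ(S))` of the points whose flow line meets `S` is closed, because `ρ(S)` is
compact. It is open, because `X` is transverse to `S`: on the tangent spaces of `S` the metric is
positive definite, while `X` is timelike. Hence a local defining function of `S` changes sign along
the flow lines near a point of `S`, and these meet `S`
(`IsSpacelikeHypersurface.eventually_exists_flow_mem`). As `M` is connected, `A = M`, and therefore
`H = ρ(M) = ρ(S)` is compact, a contradiction.
-/

/-! ### Flow of a vector field -/

section Flow

variable {E : Type*} [NormedAddCommGroup E] [NormedSpace ℝ E]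
  {H : Type*} [TopologicalSpace H] {I : ModelWithCorners ℝ E H}
  {M : Type*} [TopologicalSpace M] [ChartedSpace H M]

section MaximalCurves

variable (v : (x : M) → TangentSpace I x)

/-- The times reached by integral curves of `v` that start at `p` at time `0`: the domain of the
maximal integral curve. -/
def flowDomain (p : M) : Set ℝ :=
  {t | ∃ (a b : ℝ) (γ : ℝ → M), 0 ∈ Ioo a b ∧ t ∈ Ioo a b ∧ γ 0 = p ∧
    IsMIntegralCurveOn γ v (Ioo a b)}

open Classical in
/-- The maximal integral curve of `v` that starts at `p` at time `0`. Outside of `flowDomain v p`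
its value is `p`, by convention. -/
noncomputable def flow (p : M) (t : ℝ) : M :=
  if h : t ∈ flowDomain v p then h.choose_spec.choose_spec.choose t else p

variable {v}

theorem isOpen_flowDomain (p : M) : IsOpen (flowDomain v p) := by
  refine isOpen_iff_mem_nhds.2 fun t ⟨a, b, γ, h0, ht, hγ⟩ ↦ ?_
  filter_upwards [Ioo_mem_nhds ht.1 ht.2] with s hs
  exact ⟨a, b, γ, h0, hs, hγ⟩

theorem Ioo_subset_flowDomain {γ : ℝ → M} {a b : ℝ} (h0 : 0 ∈ Ioo a b)
    (hγ : IsMIntegralCurveOn γ v (Ioo a b)) : Ioo a b ⊆ flowDomain v (γ 0) :=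
  fun _ ht ↦ ⟨a, b, γ, h0, ht, rfl, hγ⟩

theorem ordConnected_flowDomain (p : M) : (flowDomain v p).OrdConnected := by
  refine ⟨fun s ⟨a, b, γ, h0, hs, hp, hγ⟩ t ⟨a', b', γ', h0', ht, hp', hγ'⟩ u hu ↦ ?_⟩
  rcases le_total u 0 with h | h
  · exact ⟨a, b, γ, h0, ⟨hs.1.trans_le hu.1, h.trans_lt h0.2⟩, hp, hγ⟩
  · exact ⟨a', b', γ', h0', ⟨h0'.1.trans_le h, hu.2.trans_lt ht.2⟩, hp', hγ'⟩

end MaximalCurves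

variable [I.Boundaryless] [IsManifold I 1 M]

/-- On a manifold without boundary the inverse of an extended chart is differentiable on its
(open) target. -/
theorem mdifferentiableAt_extChartAt_symm_of_boundaryless {x : M} {y : E}
    (hy : y ∈ (extChartAt I x).target) :
    MDifferentiableAt 𝓘(ℝ, E) I (extChartAt I x).symm y := by
  have h := mdifferentiableWithinAt_extChartAt_symm (I := I) hy
  rwa [I.range_eq_univ, mdifferentiableWithinAt_univ] at h

theorem mfderiv_extChartAt_symm_mfderiv_extChartAt {x p : M}
    (hp : p ∈ (extChartAt I x).source) (w : TangentSpace I p) :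
    mfderiv 𝓘(ℝ, E) I (extChartAt I x).symm (extChartAt I x p)
      (mfderiv I 𝓘(ℝ, E) (extChartAt I x) p w : E) = w := by
  have h := mfderivWithin_extChartAt_symm_comp_mfderiv_extChartAt (I := I)
    ((extChartAt I x).map_source hp)
  rw [I.range_eq_univ, mfderivWithin_univ, (extChartAt I x).left_inv hp] at h
  exact DFunLike.congr_fun h w

/-- A differentiable curve in a chart whose velocity represents the vector field `v` is an integral
curve of `v`. -/
theorem HasDerivAt.hasMFDerivAt_extChartAt_symm_comp {v : (x : M) → TangentSpace I x} {x : M}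
    {f : ℝ → E} {t : ℝ} {w : E} (hf : HasDerivAt f w t) (hft : f t ∈ (extChartAt I x).target)
    (hw : w = mfderiv I 𝓘(ℝ, E) (extChartAt I x) ((extChartAt I x).symm (f t))
      (v ((extChartAt I x).symm (f t)))) :
    HasMFDerivAt 𝓘(ℝ, ℝ) I ((extChartAt I x).symm ∘ f) t
      ((1 : ℝ →L[ℝ] ℝ).smulRight <| v ((extChartAt I x).symm (f t))) := by
  have h := (mdifferentiableAt_extChartAt_symm_of_boundaryless (I := I) hft).hasMFDerivAt.comp t
    hf.hasFDerivAt.hasMFDerivAt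
  refine h.congr_mfderiv ?_
  have key := mfderiv_extChartAt_symm_mfderiv_extChartAt (I := I)
    ((extChartAt I x).map_target hft) (v ((extChartAt I x).symm (f t)))
  rw [← hw, (extChartAt I x).right_inv hft] at key
  refine ContinuousLinearMap.ext_ring ?_
  change mfderiv 𝓘(ℝ, E) I (extChartAt I x).symm (f t) ((1 : ℝ) • w) = (1 : ℝ) • _
  rw [one_smul, one_smul]
  exact key

/-- Local flow of a `C^1` vector field, jointly continuous in time and starting point. -/
theorem exists_localFlow [CompleteSpace E] {v : (x : M) → TangentSpace I x} {x₀ : M}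
    (hv : ContMDiffAt I I.tangent 1 (fun x ↦ (⟨x, v x⟩ : TangentBundle I M)) x₀) :
    ∃ U : Set M, IsOpen U ∧ x₀ ∈ U ∧ ∃ ε > 0, ∃ φ : M × ℝ → M,
      (∀ q ∈ U, φ (q, 0) = q ∧ IsMIntegralCurveOn (fun t ↦ φ (q, t)) v (Ioo (-ε) ε)) ∧
      ContinuousOn φ (U ×ˢ Ioo (-ε) ε) := by
  rw [contMDiffAt_iff] at hv
  obtain ⟨-, hv⟩ := hv
  rw [I.range_eq_univ, contDiffWithinAt_univ] at hv
  obtain ⟨ε, hε, a, r, L, K, hr, hpl⟩ := IsPicardLindelof.of_contDiffAt_one hv.snd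
  obtain ⟨α, hα, hcont⟩ :=
    (hpl 0).exists_forall_mem_closedBall_eq_hasDerivWithinAt_continuousOn
  set y₀ : E := extChartAt I x₀ x₀ with hy₀
  have hα0 : α (y₀, 0) = y₀ := (hα y₀ (Metric.mem_closedBall_self r.2)).1
  have hnhds : Metric.closedBall y₀ r ×ˢ Icc (0 - ε) (0 + ε) ∈ 𝓝 (y₀, (0 : ℝ)) :=
    prod_mem_nhds (Metric.closedBall_mem_nhds _ (by exact_mod_cast hr))
      (Icc_mem_nhds (by linarith) (by linarith))
  have htar : α ⁻¹' (extChartAt I x₀).target ∈ 𝓝 (y₀, (0 : ℝ)) := by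
    refine (hcont.continuousAt hnhds).preimage_mem_nhds ?_
    rw [hα0]
    exact extChartAt_target_mem_nhds x₀
  obtain ⟨N, hN, T, hT, hNT⟩ := mem_nhds_prod_iff.1 (inter_mem htar hnhds)
  obtain ⟨δ, hδ, hδT⟩ := Metric.mem_nhds_iff.1 hT
  rw [Real.ball_eq_Ioo, zero_sub, zero_add] at hδT
  obtain ⟨N', hN'N, hN'o, hy₀N'⟩ := mem_nhds_iff.1 hN
  refine ⟨(extChartAt I x₀).source ∩ extChartAt I x₀ ⁻¹' N',
    (continuousOn_extChartAt x₀).isOpen_inter_preimage (isOpen_extChartAt_source x₀) hN'o,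
    ⟨mem_extChartAt_source x₀, hy₀N'⟩, δ, hδ,
    fun z ↦ (extChartAt I x₀).symm (α (extChartAt I x₀ z.1, z.2)), ?_, ?_⟩
  · rintro q ⟨hq, hqN⟩
    have hball : extChartAt I x₀ q ∈ Metric.closedBall y₀ r :=
      (hNT (mk_mem_prod (hN'N hqN) (mem_of_mem_nhds hT))).2.1
    refine ⟨?_, ?_⟩
    · simp only [(hα _ hball).1, (extChartAt I x₀).left_inv hq]
    · intro t ht
      have hmem := hNT (mk_mem_prod (hN'N hqN) (hδT ht))
      have hnt : Icc (0 - ε) (0 + ε) ∈ 𝓝 t := by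
        filter_upwards [Ioo_mem_nhds ht.1 ht.2] with s hs
        exact (hNT (mk_mem_prod (hN'N hqN) (hδT hs))).2.2
      have hd := ((hα _ hball).2 t hmem.2.2).hasDerivAt hnt
      refine (hd.hasMFDerivAt_extChartAt_symm_comp (I := I) (x := x₀) hmem.1
        ?_).hasMFDerivWithinAt
      have hsrc := (extChartAt I x₀).map_target hmem.1
      rw [extChartAt_source] at hsrc
      rw [(hasMFDerivAt_extChartAt (I := I) hsrc).mfderiv,
        mfderiv_chartAt_eq_tangentCoordChange hsrc]
      rfl
  · refine ContinuousOn.comp (continuousOn_extChartAt_symm x₀) (t := (extChartAt I x₀).target)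
      (ContinuousOn.comp hcont (t := Metric.closedBall y₀ r ×ˢ Icc (0 - ε) (0 + ε)) ?_ ?_) ?_
    · exact (((continuousOn_extChartAt x₀).mono inter_subset_left).comp continuousOn_fst
        (fun z hz ↦ hz.1)).prodMk continuousOn_snd
    · intro z hz
      exact (hNT (mk_mem_prod (hN'N hz.1.2) (hδT hz.2))).2
    · intro z hz
      exact (hNT (mk_mem_prod (hN'N hz.1.2) (hδT hz.2))).1

variable {v : (x : M) → TangentSpace I x}

theorem zero_mem_flowDomain
    [CompleteSpace E] (hv : ContMDiff I I.tangent 1 (fun x ↦ (⟨x, v x⟩ : TangentBundle I M)))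
    (p : M) :
    0 ∈ flowDomain v p := by
  obtain ⟨U, -, hpU, ε, hε, φ, hφ, -⟩ := exists_localFlow (hv p)
  have h0 : (0 : ℝ) ∈ Ioo (-ε) ε := ⟨by linarith, hε⟩
  exact ⟨-ε, ε, _, h0, h0, (hφ p hpU).1, (hφ p hpU).2⟩

variable [T2Space M]

theorem eqOn_flow (hv : ContMDiff I I.tangent 1 (fun x ↦ (⟨x, v x⟩ : TangentBundle I M)))
    {γ : ℝ → M} {a b : ℝ} (h0 : 0 ∈ Ioo a b)
    (hγ : IsMIntegralCurveOn γ v (Ioo a b)) : EqOn (flow v (γ 0)) γ (Ioo a b) := by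
  intro t ht
  have htd : t ∈ flowDomain v (γ 0) := Ioo_subset_flowDomain h0 hγ ht
  rw [flow, dif_pos htd]
  obtain ⟨h0', ht', hp', hγ'⟩ := htd.choose_spec.choose_spec.choose_spec
  set a' := htd.choose
  set b' := htd.choose_spec.choose
  exact isMIntegralCurveOn_Ioo_eqOn_of_contMDiff_boundaryless
    (a := max a' a) (b := min b' b) (t₀ := 0)
    ⟨max_lt h0'.1 h0.1, lt_min h0'.2 h0.2⟩ hv
    (hγ'.mono (Ioo_subset_Ioo (le_max_left _ _) (min_le_left _ _)))
    (hγ.mono (Ioo_subset_Ioo (le_max_right _ _) (min_le_right _ _))) hp'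
    ⟨max_lt ht'.1 ht.1, lt_min ht'.2 ht.2⟩

theorem flow_zero [CompleteSpace E]
    (hv : ContMDiff I I.tangent 1 (fun x ↦ (⟨x, v x⟩ : TangentBundle I M)))
    (p : M) : flow v p 0 = p := by
  obtain ⟨a, b, γ, h0, -, rfl, hγ⟩ := zero_mem_flowDomain hv p
  exact eqOn_flow hv h0 hγ h0

theorem isMIntegralCurveOn_flow
    (hv : ContMDiff I I.tangent 1 (fun x ↦ (⟨x, v x⟩ : TangentBundle I M))) (p : M) :
    IsMIntegralCurveOn (flow v p) v (flowDomain v p) := by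
  intro t ⟨a, b, γ, h0, ht, hp, hγ⟩
  subst hp
  have heq := eqOn_flow hv h0 hγ
  have h := (hγ t ht).hasMFDerivAt (Ioo_mem_nhds ht.1 ht.2)
  rw [← heq ht] at h
  exact (h.congr_of_eventuallyEq
    (heq.eventuallyEq_of_mem (Ioo_mem_nhds ht.1 ht.2))).hasMFDerivWithinAt

theorem continuousOn_flow
    (hv : ContMDiff I I.tangent 1 (fun x ↦ (⟨x, v x⟩ : TangentBundle I M))) (p : M) :
    ContinuousOn (flow v p) (flowDomain v p) :=
  (isMIntegralCurveOn_flow hv p).continuousOn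

/-- The group law of the flow, one inclusion of domains: a curve through `p` followed by a curve
through `flow v p s` is again a curve through `p`. -/
theorem flow_add_aux (hv : ContMDiff I I.tangent 1 (fun x ↦ (⟨x, v x⟩ : TangentBundle I M)))
    {p : M} {s t : ℝ} (hs : s ∈ flowDomain v p) (ht : t ∈ flowDomain v (flow v p s)) :
    s + t ∈ flowDomain v p ∧ flow v p (s + t) = flow v (flow v p s) t := by
  obtain ⟨a, b, γ, h0, hs', rfl, hγ⟩ := hs
  obtain ⟨c, d, γ', h0', ht', hp', hγ'⟩ := ht
  have hγs : flow v (γ 0) s = γ s := eqOn_flow hv h0 hγ hs'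
  rw [hγs] at hp' ⊢
  have hγ'' : IsMIntegralCurveOn (γ' ∘ (· + -s)) v (Ioo (c + s) (d + s)) := by
    refine (hγ'.comp_add (-s)).mono fun u hu ↦ ?_
    exact ⟨by linarith [hu.1], by linarith [hu.2]⟩
  have hmem : s ∈ Ioo a b ∩ Ioo (c + s) (d + s) :=
    ⟨hs', by linarith [h0'.1], by linarith [h0'.2]⟩
  have hval : γ s = (γ' ∘ (· + -s)) s := by simp [hp']
  have hglue := isMIntegralCurveOn_piecewise hv hγ hγ'' hmem hval
  have heq := eqOn_piecewise_of_isMIntegralCurveOn_Ioo hv hγ hγ'' hmem hval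
  rw [Ioo_union_Ioo' (by linarith [hmem.1.2, hmem.2.1]) (by linarith [hmem.1.1, hmem.2.2])]
    at hglue
  have h0u : (0 : ℝ) ∈ Ioo (min a (c + s)) (max b (d + s)) :=
    ⟨min_lt_of_left_lt h0.1, lt_max_of_lt_left h0.2⟩
  have hst : s + t ∈ Ioo (c + s) (d + s) := ⟨by linarith [ht'.1], by linarith [ht'.2]⟩
  have hstu : s + t ∈ Ioo (min a (c + s)) (max b (d + s)) :=
    ⟨min_lt_of_right_lt hst.1, lt_max_of_lt_right hst.2⟩
  have hz : (Ioo a b).piecewise γ (γ' ∘ (· + -s)) 0 = γ 0 := piecewise_eq_of_mem _ _ _ h0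
  have h1 := Ioo_subset_flowDomain h0u hglue hstu
  have h2 := eqOn_flow hv h0u hglue hstu
  rw [hz] at h1 h2
  refine ⟨h1, ?_⟩
  rw [h2, heq hst, ← hp', eqOn_flow hv h0' hγ' ht']
  simp

theorem neg_mem_flowDomain
    (hv : ContMDiff I I.tangent 1 (fun x ↦ (⟨x, v x⟩ : TangentBundle I M)))
    {p : M} {s : ℝ} (hs : s ∈ flowDomain v p) :
    -s ∈ flowDomain v (flow v p s) ∧ flow v (flow v p s) (-s) = p := by
  obtain ⟨a, b, γ, h0, hs', rfl, hγ⟩ := hs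
  have hγ'' : IsMIntegralCurveOn (γ ∘ (· + s)) v (Ioo (a - s) (b - s)) := by
    refine (hγ.comp_add s).mono fun u hu ↦ ?_
    exact ⟨by linarith [hu.1], by linarith [hu.2]⟩
  have hz : (γ ∘ (· + s)) 0 = flow v (γ 0) s := by simp [eqOn_flow hv h0 hγ hs']
  have h0u : (0 : ℝ) ∈ Ioo (a - s) (b - s) := ⟨by linarith [hs'.1], by linarith [hs'.2]⟩
  have hsu : -s ∈ Ioo (a - s) (b - s) := ⟨by linarith [h0.1], by linarith [h0.2]⟩
  rw [← hz]
  exact ⟨Ioo_subset_flowDomain h0u hγ'' hsu, by rw [eqOn_flow hv h0u hγ'' hsu]; simp⟩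

/-- The group law of the flow. -/
theorem add_mem_flowDomain_iff
    (hv : ContMDiff I I.tangent 1 (fun x ↦ (⟨x, v x⟩ : TangentBundle I M)))
    {p : M} {s t : ℝ} (hs : s ∈ flowDomain v p) :
    s + t ∈ flowDomain v p ↔ t ∈ flowDomain v (flow v p s) := by
  refine ⟨fun h ↦ ?_, fun h ↦ (flow_add_aux hv hs h).1⟩
  obtain ⟨h1, h2⟩ := neg_mem_flowDomain hv hs
  have h3 := (flow_add_aux hv h1 (t := s + t) (by rwa [h2])).1
  rwa [neg_add_cancel_left] at h3

theorem flow_add (hv : ContMDiff I I.tangent 1 (fun x ↦ (⟨x, v x⟩ : TangentBundle I M)))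
    {p : M} {s t : ℝ} (hs : s ∈ flowDomain v p) (ht : t ∈ flowDomain v (flow v p s)) :
    flow v p (s + t) = flow v (flow v p s) t :=
  (flow_add_aux hv hs ht).2

variable [CompleteSpace E]

/-- Near every point the flow is defined for a uniform time, and jointly continuous. -/
theorem exists_continuousOn_flow
    (hv : ContMDiff I I.tangent 1 (fun x ↦ (⟨x, v x⟩ : TangentBundle I M))) (x₀ : M) :
    ∃ U : Set M, IsOpen U ∧ x₀ ∈ U ∧ ∃ ε > 0, (∀ q ∈ U, Ioo (-ε) ε ⊆ flowDomain v q) ∧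
      ContinuousOn (fun z : M × ℝ ↦ flow v z.1 z.2) (U ×ˢ Ioo (-ε) ε) := by
  obtain ⟨U, hU, hxU, ε, hε, φ, hφ, hc⟩ := exists_localFlow (hv x₀)
  have h0 : (0 : ℝ) ∈ Ioo (-ε) ε := ⟨by linarith, hε⟩
  refine ⟨U, hU, hxU, ε, hε, fun q hq ↦ ?_, hc.congr ?_⟩
  · have h := Ioo_subset_flowDomain h0 (hφ q hq).2
    rwa [(hφ q hq).1] at h
  · rintro ⟨q, t⟩ ⟨hq, ht⟩
    have h := eqOn_flow hv h0 (hφ q hq).2 ht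
    rwa [(hφ q hq).1] at h

/-- If the translates of a flow line by all sufficiently small times in `K` still tend to `y`, then
`y` is fixed by the flow for these times, so that `v` vanishes at `y`. -/
theorem eq_zero_of_tendsto_flow
    (hv : ContMDiff I I.tangent 1 (fun x ↦ (⟨x, v x⟩ : TangentBundle I M)))
    {p y : M} {l : Filter ℝ} [l.NeBot] (hl : ∀ᶠ t in l, t ∈ flowDomain v p)
    (hy : Tendsto (flow v p) l (𝓝 y)) {K : Set ℝ}
    (hK : ∀ ε > 0, ∃ s ∈ Ioo (-ε) ε, K ∈ 𝓝 s)
    (hlK : ∀ s ∈ K, (∀ᶠ t in l, t + s ∈ flowDomain v p) → Tendsto (· + s) l l) :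
    v y = 0 := by
  obtain ⟨U, hU, hyU, ε, hε, hdom, hc⟩ := exists_continuousOn_flow hv y
  -- `flow v p (t + s)` tends to `y`, and to `flow v y s` by continuity of the flow
  have hfix : ∀ s ∈ K ∩ Ioo (-ε) ε, flow v y s = y := by
    rintro s ⟨hsK, hs⟩
    have hUl : ∀ᶠ t in l, flow v p t ∈ U := hy (hU.mem_nhds hyU)
    have hts : ∀ᶠ t in l, t + s ∈ flowDomain v p := by
      filter_upwards [hl, hUl] with t ht htU
      exact (add_mem_flowDomain_iff hv ht).2 (hdom _ htU hs)
    have h1 : Tendsto (fun t ↦ flow v p (t + s)) l (𝓝 y) := hy.comp (hlK s hsK hts)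
    have h2 : Tendsto (fun t ↦ flow v (flow v p t) s) l (𝓝 (flow v y s)) := by
      have hcy : ContinuousAt (fun q ↦ flow v q s) y :=
        ContinuousAt.comp (f := fun q : M ↦ (q, s)) (g := fun z : M × ℝ ↦ flow v z.1 z.2)
          (hc.continuousAt (prod_mem_nhds (hU.mem_nhds hyU) (Ioo_mem_nhds hs.1 hs.2)))
          (by fun_prop)
      exact hcy.tendsto.comp hy
    refine tendsto_nhds_unique (h2.congr' ?_) h1
    filter_upwards [hl, hUl] with t ht htU
    exact (flow_add hv ht (hdom _ htU hs)).symm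
  obtain ⟨s, hs, hsK⟩ := hK ε hε
  have hd := (isMIntegralCurveOn_flow hv y s (hdom y hyU hs)).hasMFDerivAt
    ((isOpen_flowDomain y).mem_nhds (hdom y hyU hs))
  have hev : (fun _ ↦ y) =ᶠ[𝓝 s] flow v y := by
    filter_upwards [hsK, Ioo_mem_nhds hs.1 hs.2] with u hu hu'
    exact (hfix u ⟨hu, hu'⟩).symm
  have huniq := hasMFDerivAt_unique hd
    ((hasMFDerivAt_const (I := 𝓘(ℝ, ℝ)) (I' := I) y s).congr_of_eventuallyEq hev.symm)
  have h1 := DFunLike.congr_fun huniq (1 : ℝ)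
  have h2 : (1 : ℝ) • v (flow v y s) = 0 := h1
  rw [one_smul, hfix s ⟨mem_of_mem_nhds hsK, hs⟩] at h2
  exact h2

/-- A union `A` of flow lines that is a neighbourhood of one point of a flow line is a neighbourhood
of every point of that line, since the local flow is continuous in the starting point. -/
theorem mem_nhds_of_mem_nhds_flow
    (hv : ContMDiff I I.tangent 1 (fun x ↦ (⟨x, v x⟩ : TangentBundle I M)))
    {A : Set M} (hA : ∀ q, ∀ t ∈ flowDomain v q, flow v q t ∈ A → q ∈ A)
    {p : M} {t : ℝ} (ht : t ∈ flowDomain v p) (hAt : A ∈ 𝓝 (flow v p t)) : A ∈ 𝓝 p := by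
  -- the transport over a time for which the flow is uniformly defined and continuous
  have step : ∀ (U : Set M) (ε : ℝ), IsOpen U → (∀ q ∈ U, Ioo (-ε) ε ⊆ flowDomain v q) →
      ContinuousOn (fun z : M × ℝ ↦ flow v z.1 z.2) (U ×ˢ Ioo (-ε) ε) →
      ∀ q ∈ U, ∀ s ∈ Ioo (-ε) ε, A ∈ 𝓝 (flow v q s) → A ∈ 𝓝 q := by
    intro U ε hU hdom hc q hq s hs hAs
    have hcq : ContinuousAt (fun q ↦ flow v q s) q :=
      ContinuousAt.comp (f := fun q : M ↦ (q, s)) (g := fun z : M × ℝ ↦ flow v z.1 z.2)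
        (hc.continuousAt (prod_mem_nhds (hU.mem_nhds hq) (Ioo_mem_nhds hs.1 hs.2)))
        (by fun_prop)
    filter_upwards [hcq.preimage_mem_nhds hAs, hU.mem_nhds hq] with q' hq' hq'U
    exact hA q' s (hdom q' hq'U hs) hq'
  -- the condition is locally constant along the flow line, hence constant
  have main : ∀ s ∈ flowDomain v p, ∀ᶠ u in 𝓝[flowDomain v p] s,
      (A ∈ 𝓝 (flow v p s) ↔ A ∈ 𝓝 (flow v p u)) := by
    intro s hs
    obtain ⟨U, hU, hxU, ε, hε, hdom, hc⟩ := exists_continuousOn_flow hv (flow v p s)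
    have h1 : ∀ᶠ u in 𝓝[flowDomain v p] s, flow v p u ∈ U :=
      continuousOn_flow hv p s hs (hU.mem_nhds hxU)
    have h2 : ∀ᶠ u in 𝓝[flowDomain v p] s, u ∈ Ioo (s - ε) (s + ε) :=
      mem_nhdsWithin_of_mem_nhds (Ioo_mem_nhds (by linarith) (by linarith))
    filter_upwards [h1, h2, self_mem_nhdsWithin] with u hu hu' hud
    have hus : u - s ∈ Ioo (-ε) ε := ⟨by linarith [hu'.1], by linarith [hu'.2]⟩
    have hsu : s - u ∈ Ioo (-ε) ε := ⟨by linarith [hu'.2], by linarith [hu'.1]⟩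
    constructor
    · intro h
      refine step U ε hU hdom hc _ hu _ hsu ?_
      rwa [← flow_add hv hud (hdom _ hu hsu), add_sub_cancel]
    · intro h
      refine step U ε hU hdom hc _ hxU _ hus ?_
      rwa [← flow_add hv hs (hdom _ hxU hus), add_sub_cancel]
  have h := (ordConnected_flowDomain p).isPreconnected.induction₂
    (fun s u ↦ (A ∈ 𝓝 (flow v p s) ↔ A ∈ 𝓝 (flow v p u))) main
    (fun _ _ _ _ _ _ h h' ↦ h.trans h') (fun _ _ _ _ h ↦ h.symm)
    (zero_mem_flowDomain hv p) ht
  rw [flow_zero hv] at h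
  exact h.2 hAt

/-- A maximal integral curve of a vector field without zeros has no end points. -/
theorem isInextendible_flow
    (hv : ContMDiff I I.tangent 1
      (fun x ↦ (⟨x, v x⟩ : TangentBundle I M)))
    (hv0 : ∀ x, v x ≠ 0) (p : M) : IsInextendible (flow v p) (flowDomain v p) := by
  have : Nonempty (flowDomain v p) := ⟨⟨0, zero_mem_flowDomain hv p⟩⟩
  refine ⟨fun y hy ↦ hv0 y ?_, fun y hy ↦ hv0 y ?_⟩
  · refine eq_zero_of_tendsto_flow hv (p := p)
      (l := map Subtype.val (atTop : Filter (flowDomain v p))) (K := Ioi 0)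
      (eventually_map.2 (Eventually.of_forall fun t ↦ t.2)) (tendsto_map'_iff.2 hy)
      (fun ε hε ↦ ⟨ε / 2, ⟨by linarith, by linarith⟩, Ioi_mem_nhds (by linarith)⟩) ?_
    intro s hs hdom U hU
    obtain ⟨t₀, ht₀⟩ := mem_atTop_sets.1 (mem_map.1 hU)
    change ∀ᶠ t : flowDomain v p in atTop, (t : ℝ) + s ∈ U
    filter_upwards [mem_map.1 hdom, Ici_mem_atTop t₀] with t ht htt₀
    have ht' : (t : ℝ) + s ∈ flowDomain v p := ht
    have hle : (t₀ : ℝ) ≤ t := htt₀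
    have hs' : 0 < s := hs
    exact ht₀ ⟨t + s, ht'⟩ (show (t₀ : ℝ) ≤ t + s by linarith)
  · refine eq_zero_of_tendsto_flow hv (p := p)
      (l := map Subtype.val (atBot : Filter (flowDomain v p))) (K := Iio 0)
      (eventually_map.2 (Eventually.of_forall fun t ↦ t.2)) (tendsto_map'_iff.2 hy)
      (fun ε hε ↦ ⟨-(ε / 2), ⟨by linarith, by linarith⟩, Iio_mem_nhds (by linarith)⟩) ?_
    intro s hs hdom U hU
    obtain ⟨t₀, ht₀⟩ := mem_atBot_sets.1 (mem_map.1 hU)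
    change ∀ᶠ t : flowDomain v p in atBot, (t : ℝ) + s ∈ U
    filter_upwards [mem_map.1 hdom, Iic_mem_atBot t₀] with t ht htt₀
    have ht' : (t : ℝ) + s ∈ flowDomain v p := ht
    have hle : (t : ℝ) ≤ t₀ := htt₀
    have hs' : s < 0 := hs
    exact ht₀ ⟨t + s, ht'⟩ (show (t : ℝ) + s ≤ t₀ by linarith)

end Flow

/-! ### The future timelike cone -/

section FutureCone

variable {n : ℕ} {k : ℕ∞} {M : Type*} [TopologicalSpace M]
  [ChartedSpace (EuclideanSpace ℝ (Fin (n + 1))) M] [IsManifold (𝓡 (n + 1)) ∞ M]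

/-- The orthogonal complement of an arbitrary timelike vector is positive semidefinite: otherwise
there would be a negative definite plane, which meets the positive definite hyperplane of the
signature condition. -/
theorem LorentzianMetric.nonneg_of_orthogonal (g : LorentzianMetric n k M) {x : M}
    {v u : TangentSpace (𝓡 (n + 1)) x} (hv : g.val x v v < 0) (hvu : g.val x v u = 0) :
    0 ≤ g.val x u u := by
  obtain ⟨e, -, he⟩ := g.signature x
  by_contra! hu
  have huv : g.val x u v = 0 := by rw [g.symm, hvu]
  have hv0 : v ≠ 0 := by
    rintro rfl
    simp at hv
  -- a vector of the plane spanned by `v` and `u` that is orthogonal to `e`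
  set w := g.val x e u • v - g.val x e v • u with hw
  have hew : g.val x e w = 0 := by
    simp only [hw, map_sub, map_smul, smul_eq_mul]
    ring
  have hww : g.val x w w = (g.val x e u) ^ 2 * g.val x v v + (g.val x e v) ^ 2 * g.val x u u := by
    simp only [hw, map_sub, map_smul, smul_eq_mul, _root_.sub_apply,
      _root_.smul_apply, hvu, huv]
    ring
  have hev : g.val x e v ≠ 0 := fun h ↦ (he v hv0 h).not_gt hv
  have hneg : g.val x w w < 0 := by
    rw [hww]
    have h1 : (g.val x e u) ^ 2 * g.val x v v ≤ 0 :=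
      mul_nonpos_of_nonneg_of_nonpos (sq_nonneg _) hv.le
    have h2 : (g.val x e v) ^ 2 * g.val x u u < 0 := mul_neg_of_pos_of_neg (by positivity) hu
    linarith
  refine (he w ?_ hew).not_gt hneg
  rintro h0
  simp [h0] at hneg

/-- Two future timelike vectors have negative scalar product. -/
theorem IsFutureTimelike.val_neg {g : LorentzianMetric n k M} {T : TimeOrientation g} {x : M}
    {v w : TangentSpace (𝓡 (n + 1)) x} (hv : IsFutureTimelike g T x v)
    (hw : IsFutureTimelike g T x w) : g.val x v w < 0 := by
  obtain ⟨hv1, hv2⟩ := hv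
  obtain ⟨hw1, hw2⟩ := hw
  -- a combination of `v` and `w` that is orthogonal to the time orientation
  have h := g.nonneg_of_orthogonal (T.timelike x)
    (u := g.val x (T.field x) w • v - g.val x (T.field x) v • w) (by
      simp only [map_sub, map_smul, smul_eq_mul]
      ring)
  simp only [map_sub, map_smul, smul_eq_mul, _root_.sub_apply,
    _root_.smul_apply, g.symm x w v] at h
  set a := g.val x (T.field x) w
  set b := g.val x (T.field x) v
  have hab : 0 < a * b := mul_pos_of_neg_of_neg hw2 hv2
  have h1 : a ^ 2 * g.val x v v < 0 := mul_neg_of_pos_of_neg (by nlinarith) hv1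
  have h2 : b ^ 2 * g.val x w w < 0 := mul_neg_of_pos_of_neg (by nlinarith) hw1
  have h3 : (a * b) * g.val x v w < 0 := by nlinarith
  exact neg_of_mul_neg_right h3 hab.le

theorem convex_setOf_isFutureTimelike (g : LorentzianMetric n k M) (T : TimeOrientation g)
    (x : M) : Convex ℝ {v | IsFutureTimelike g T x v} := by
  refine convex_iff_forall_pos.2 fun v hv w hw a b ha hb _ ↦ ⟨?_, ?_⟩
  · have hvw := IsFutureTimelike.val_neg hv hw
    simp only [map_add, map_smul, smul_eq_mul, _root_.add_apply,
      _root_.smul_apply, g.symm x w v]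
    have h1 : a * (a * g.val x v v) < 0 := mul_neg_of_pos_of_neg ha (mul_neg_of_pos_of_neg ha hv.1)
    have h2 : b * (b * g.val x w w) < 0 := mul_neg_of_pos_of_neg hb (mul_neg_of_pos_of_neg hb hw.1)
    have h3 : a * (b * g.val x v w) < 0 := mul_neg_of_pos_of_neg ha (mul_neg_of_pos_of_neg hb hvw)
    have h4 : b * (a * g.val x v w) < 0 := mul_neg_of_pos_of_neg hb (mul_neg_of_pos_of_neg ha hvw)
    linarith
  · simp only [map_add, map_smul, smul_eq_mul]
    exact add_neg (mul_neg_of_pos_of_neg ha hv.2) (mul_neg_of_pos_of_neg hb hw.2)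

theorem IsFutureTimelike.ne_zero {g : LorentzianMetric n k M} {T : TimeOrientation g} {x : M}
    {v : TangentSpace (𝓡 (n + 1)) x} (hv : IsFutureTimelike g T x v) : v ≠ 0 := by
  rintro rfl
  simpa using hv.1

theorem LorentzianMetric.continuous_val (g : LorentzianMetric n k M) {N : Type*}
    [TopologicalSpace N] {b : N → M} {v w : (y : N) → TangentSpace (𝓡 (n + 1)) (b y)}
    (hv : Continuous fun y ↦ (⟨b y, v y⟩ : TangentBundle (𝓡 (n + 1)) M))
    (hw : Continuous fun y ↦ (⟨b y, w y⟩ : TangentBundle (𝓡 (n + 1)) M)) :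
    Continuous fun y ↦ g.val (b y) (v y) (w y) := by
  have hb : Continuous b := (FiberBundle.continuous_proj (EuclideanSpace ℝ (Fin (n + 1)))
    (TangentSpace (𝓡 (n + 1)) (M := M))).comp hv
  have h := Continuous.clm_bundle_apply₂ (F₁ := EuclideanSpace ℝ (Fin (n + 1)))
    (F₂ := EuclideanSpace ℝ (Fin (n + 1))) (F₃ := ℝ) (E₃ := Bundle.Trivial M ℝ)
    (b := b) (ψ := fun y ↦ g.val (b y))
    (g.contMDiff.continuous.comp hb) hv hw
  exact ((Bundle.Trivial.homeomorphProd M ℝ).continuous.comp h).snd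

theorem isOpen_setOf_isFutureTimelike (g : LorentzianMetric n k M) (T : TimeOrientation g) :
    IsOpen {z : TangentBundle (𝓡 (n + 1)) M | IsFutureTimelike g T z.1 z.2} := by
  have hproj : Continuous fun z : TangentBundle (𝓡 (n + 1)) M ↦ z.1 :=
    FiberBundle.continuous_proj _ _
  refine IsOpen.inter (isOpen_lt (g.continuous_val continuous_id continuous_id) continuous_const)
    (isOpen_lt (g.continuous_val (T.continuous.comp hproj) continuous_id) continuous_const)

/-- Every spacetime has a future timelike vector field of class `C^1`, although the time orientation
is only continuous: locally a `C^1` field that agrees with the time orientation at a point, globally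
by a partition of unity, since the future cones are convex. -/
theorem exists_contMDiff_isFutureTimelike [T2Space M] [SigmaCompactSpace M]
    (g : LorentzianMetric n k M) (T : TimeOrientation g) :
    ∃ X : (x : M) → TangentSpace (𝓡 (n + 1)) x,
      ContMDiff (𝓡 (n + 1)) (𝓡 (n + 1)).tangent 1
        (fun x ↦ (⟨x, X x⟩ : TangentBundle (𝓡 (n + 1)) M)) ∧
      ∀ x, IsFutureTimelike g T x (X x) := by
  obtain ⟨s, hs⟩ := exists_contMDiffSection_forall_mem_convex_of_local (n := 1) (𝓡 (n + 1))
    (F_fiber := EuclideanSpace ℝ (Fin (n + 1)))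
    (TangentSpace (𝓡 (n + 1)) (M := M)) (fun x ↦ {v | IsFutureTimelike g T x v})
    (convex_setOf_isFutureTimelike g T) (by
      intro x₀
      obtain ⟨U, hU, hsm⟩ := FiberBundle.exists_contMDiffOn_extend (k := 1)
        (I := 𝓡 (n + 1)) (F := EuclideanSpace ℝ (Fin (n + 1))) (T.field x₀)
      set Y := FiberBundle.extend (EuclideanSpace ℝ (Fin (n + 1))) (T.field x₀)
      have hY : ∀ᶠ x in 𝓝 x₀, IsFutureTimelike g T x (Y x) :=
        (hsm.continuousOn.continuousAt hU).preimage_mem_nhds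
          ((isOpen_setOf_isFutureTimelike g T).mem_nhds (by
            simp only [Y, FiberBundle.extend_apply_self, mem_ofPred_eq]
            exact ⟨T.timelike x₀, T.timelike x₀⟩))
      exact ⟨_, inter_mem hU hY, Y, hsm.mono inter_subset_left, fun x hx ↦ hx.2⟩)
  exact ⟨s, s.contMDiff, hs⟩

end FutureCone

/-! ### Timelike curves -/

section IntegralCurve

variable {E : Type*} [NormedAddCommGroup E] [NormedSpace ℝ E]
  {H : Type*} [TopologicalSpace H] {I : ModelWithCorners ℝ E H}
  {M : Type*} [TopologicalSpace M] [ChartedSpace H M] [IsManifold I 1 M]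

/-- Integral curves of a continuous vector field are `C^1`. -/
theorem IsMIntegralCurveOn.contMDiffOn {v : (x : M) → TangentSpace I x} {γ : ℝ → M} {J : Set ℝ}
    (hγ : IsMIntegralCurveOn γ v J) (hJ : IsOpen J)
    (hv : Continuous (fun x ↦ (⟨x, v x⟩ : TangentBundle I M))) :
    ContMDiffOn 𝓘(ℝ, ℝ) I 1 γ J := by
  intro t₀ ht₀
  refine ContMDiffAt.contMDiffWithinAt ?_
  have hat := hγ.isMIntegralCurveAt (hJ.mem_nhds ht₀)
  refine contMDiffAt_iff.2 ⟨hat.continuousAt, ContDiffAt.contDiffWithinAt ?_⟩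
  change ContDiffAt ℝ 1 (extChartAt I (γ t₀) ∘ γ) t₀
  set e := trivializationAt E (TangentSpace I (M := M)) (γ t₀)
  have hnear : ∀ᶠ t in 𝓝 t₀, γ t ∈ e.baseSet :=
    hat.continuousAt (e.open_baseSet.mem_nhds (FiberBundle.mem_baseSet_trivializationAt' _))
  obtain ⟨u, hu, huo, htu⟩ := eventually_nhds_iff.1
    ((hat.eventually_hasDerivAt.and hnear).and (hJ.mem_nhds ht₀))
  refine contDiffAt_one_iff.2
    ⟨fun t ↦ (1 : ℝ →L[ℝ] ℝ).smulRight (e ⟨γ t, v (γ t)⟩).2, u, huo.mem_nhds htu, ?_,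
      fun t ht ↦ (hu t ht).1.1.hasFDerivAt⟩
  have hc : ContinuousOn (fun t ↦ (e ⟨γ t, v (γ t)⟩).2) u := by
    refine continuous_snd.comp_continuousOn (e.continuousOn.comp
      (hv.comp_continuousOn (hγ.continuousOn.mono fun t ht ↦ (hu t ht).2)) fun t ht ↦ ?_)
    exact e.mem_source.2 (hu t ht).1.2
  exact ((ContinuousLinearMap.smulRightL ℝ ℝ E 1).continuous.comp_continuousOn hc)

/-- The coordinate form of the velocity of an integral curve at `t₀`, in the chart at `γ t₀`. -/
theorem IsMIntegralCurveAt.hasDerivAt_extChartAt_comp {v : (x : M) → TangentSpace I x} {γ : ℝ → M}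
    {t₀ : ℝ} (hγ : IsMIntegralCurveAt γ v t₀) :
    HasDerivAt (extChartAt I (γ t₀) ∘ γ)
      (mfderiv I 𝓘(ℝ, E) (extChartAt I (γ t₀)) (γ t₀) (v (γ t₀)) : E) t₀ := by
  have hsrc := mem_chart_source H (γ t₀)
  refine hγ.eventually_hasDerivAt.self_of_nhds.congr_deriv ?_
  rw [(hasMFDerivAt_extChartAt (I := I) hsrc).mfderiv, mfderiv_chartAt_eq_tangentCoordChange hsrc]
  rfl

/-- The tangent map of the inverse of a chart is continuous. -/
theorem continuousOn_mfderiv_extChartAt_symm [I.Boundaryless] (x : M) :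
    ContinuousOn (fun z : E × E ↦ (⟨(extChartAt I x).symm z.1,
      mfderiv 𝓘(ℝ, E) I (extChartAt I x).symm z.1 z.2⟩ : TangentBundle I M))
      ((extChartAt I x).target ×ˢ univ) := by
  have hopen : IsOpen (extChartAt I x).target := isOpen_extChartAt_target x
  have h1 := (contMDiffOn_extChartAt_symm (I := I) (n := 1) x).continuousOn_tangentMapWithin
    le_rfl hopen.uniqueMDiffOn
  have h2 : Continuous (fun z : E × E ↦ (⟨z.1, z.2⟩ : TangentBundle 𝓘(ℝ, E) E)) :=
    (tangentBundleModelSpaceHomeomorph 𝓘(ℝ, E)).symm.continuous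
  refine (h1.comp h2.continuousOn (fun z hz ↦ hz.1)).congr fun z hz ↦ ?_
  simp only [Function.comp, tangentMapWithin]
  rw [mfderivWithin_of_isOpen hopen hz.1]

/-- Given an open set `C` of tangent vectors, straight segments in a chart with end points close to
`x` and velocity close to that of a vector of `C` at `x` are curves with velocity in `C`. -/
theorem exists_nhds_segment_extChartAt_symm_mem [I.Boundaryless] {C : Set (TangentBundle I M)}
    (hC : IsOpen C) {x : M} {w₀ : TangentSpace I x} (hw₀ : (⟨x, w₀⟩ : TangentBundle I M) ∈ C) :
    ∃ Y ∈ 𝓝 (extChartAt I x x), ∃ W ∈ 𝓝 (mfderiv I 𝓘(ℝ, E) (extChartAt I x) x w₀ : E),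
      ∀ (a b : ℝ), a < b → ∀ y₀ ∈ Y, ∀ y₁ ∈ Y, (b - a)⁻¹ • (y₁ - y₀) ∈ W →
        ContMDiffOn 𝓘(ℝ, ℝ) I 1
          (fun s ↦ (extChartAt I x).symm (y₀ + (s - a) • (b - a)⁻¹ • (y₁ - y₀))) (Icc a b) ∧
        ∀ s ∈ Icc a b, (⟨(extChartAt I x).symm (y₀ + (s - a) • (b - a)⁻¹ • (y₁ - y₀)),
          mfderivWithin 𝓘(ℝ, ℝ) I
            (fun s ↦ (extChartAt I x).symm (y₀ + (s - a) • (b - a)⁻¹ • (y₁ - y₀))) (Icc a b) s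
            (1 : ℝ)⟩ : TangentBundle I M) ∈ C := by
  set ψ := (extChartAt I x).symm with hψ
  set tgt := (extChartAt I x).target with htgt
  have hψs : ContMDiffOn 𝓘(ℝ, E) I 1 ψ tgt := contMDiffOn_extChartAt_symm x
  -- the pairs of a point and a vector in the chart that represent a vector of `C`
  have hN : {z : E × E | z.1 ∈ tgt ∧
        (⟨ψ z.1, mfderiv 𝓘(ℝ, E) I ψ z.1 z.2⟩ : TangentBundle I M) ∈ C} ∈
      𝓝 ((extChartAt I x x : E), (mfderiv I 𝓘(ℝ, E) (extChartAt I x) x w₀ : E)) := by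
    have hmem : tgt ×ˢ (univ : Set E) ∈
        𝓝 ((extChartAt I x x : E), (mfderiv I 𝓘(ℝ, E) (extChartAt I x) x w₀ : E)) :=
      prod_mem_nhds (extChartAt_target_mem_nhds x) univ_mem
    have h3 : (⟨ψ (extChartAt I x x), mfderiv 𝓘(ℝ, E) I ψ (extChartAt I x x)
          (mfderiv I 𝓘(ℝ, E) (extChartAt I x) x w₀ : E)⟩ : TangentBundle I M) ∈ C := by
      have key : ∀ (p : M) (w : E), p = x → w = w₀ → (⟨p, w⟩ : TangentBundle I M) ∈ C := by
        rintro p w rfl rfl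
        exact hw₀
      exact key _ _ (extChartAt_to_inv x)
        (mfderiv_extChartAt_symm_mfderiv_extChartAt (mem_extChartAt_source x) w₀)
    filter_upwards [hmem, ((continuousOn_mfderiv_extChartAt_symm x).continuousAt
      hmem).preimage_mem_nhds (hC.mem_nhds h3)] with z hz hz'
    exact ⟨hz.1, hz'⟩
  obtain ⟨Y', hY', W, hW, hYW⟩ := mem_nhds_prod_iff.1 hN
  obtain ⟨r, hr, hrY⟩ := Metric.mem_nhds_iff.1 hY'
  refine ⟨Metric.ball (extChartAt I x x) r, Metric.ball_mem_nhds _ hr, W, hW, ?_⟩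
  intro a b hab y₀ hy₀ y₁ hy₁ hw
  set w := (b - a)⁻¹ • (y₁ - y₀) with hwdef
  have hba : 0 < b - a := sub_pos.2 hab
  have hmem : ∀ s ∈ Icc a b, y₀ + (s - a) • w ∈ Y' := by
    intro s hs
    refine hrY ?_
    have h := (convex_ball (extChartAt I x x) r).add_smul_sub_mem hy₀ hy₁
      (t := (s - a) * (b - a)⁻¹) ⟨mul_nonneg (by linarith [hs.1]) (by positivity), by
        rw [← div_eq_mul_inv, div_le_one hba]; linarith [hs.2]⟩
    rwa [mul_smul] at h
  have hder : ∀ s : ℝ, HasDerivAt (fun s : ℝ ↦ y₀ + (s - a) • w) w s := by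
    intro s
    simpa using (((hasDerivAt_id s).sub_const a).smul_const w).const_add y₀
  refine ⟨hψs.comp (ContDiff.contMDiff (by fun_prop)).contMDiffOn
    (fun s hs ↦ (hYW (mk_mem_prod (hmem s hs) (mem_of_mem_nhds hW))).1), fun s hs ↦ ?_⟩
  obtain ⟨ht, hft⟩ := hYW (mk_mem_prod (hmem s hs) hw)
  have hd := ((mdifferentiableAt_extChartAt_symm_of_boundaryless (I := I) ht).hasMFDerivAt.comp s
    (hder s).hasFDerivAt.hasMFDerivAt).hasMFDerivWithinAt (s := Icc a b)
  have h1 := hd.mfderivWithin (uniqueDiffOn_Icc hab s hs).uniqueMDiffWithinAt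
  have h2 : mfderivWithin 𝓘(ℝ, ℝ) I (fun s : ℝ ↦ ψ (y₀ + (s - a) • w)) (Icc a b) s (1 : ℝ) =
      mfderiv 𝓘(ℝ, E) I ψ (y₀ + (s - a) • w) w := by
    refine (DFunLike.congr_fun h1 (1 : ℝ)).trans ?_
    change mfderiv 𝓘(ℝ, E) I ψ (y₀ + (s - a) • w) ((1 : ℝ) • w) = _
    rw [one_smul]
  exact h2.symm ▸ hft

end IntegralCurve

section TimelikeCurves

variable {n : ℕ} {k : ℕ∞} {M : Type*} [TopologicalSpace M]
  [ChartedSpace (EuclideanSpace ℝ (Fin (n + 1))) M] [IsManifold (𝓡 (n + 1)) ∞ M]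
  {g : LorentzianMetric n k M} {T : TimeOrientation g}

theorem IsMIntegralCurveOn.isFutureTimelikeOnIcc {X : (x : M) → TangentSpace (𝓡 (n + 1)) x}
    (hXc : Continuous (fun x ↦ (⟨x, X x⟩ : TangentBundle (𝓡 (n + 1)) M)))
    (hX : ∀ x, IsFutureTimelike g T x (X x)) {γ : ℝ → M} {J : Set ℝ} (hJ : IsOpen J)
    (hγ : IsMIntegralCurveOn γ X J) {a b : ℝ} (hab : a < b) (h : Icc a b ⊆ J) :
    IsFutureTimelikeOnIcc g T γ a b := by
  refine ⟨(hγ.contMDiffOn hJ hXc).mono h, fun s hs ↦ ?_⟩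
  rw [((hγ s (h hs)).mono h).mfderivWithin
    (uniqueDiffOn_Icc hab s hs).uniqueMDiffWithinAt]
  have : (1 : ℝ →L[ℝ] ℝ).smulRight (X (γ s)) (1 : ℝ) = X (γ s) := one_smul ℝ _
  exact this.symm ▸ hX (γ s)

theorem IsFutureTimelikeOnIcc.mono {γ : ℝ → M} {a b a' b' : ℝ}
    (h : IsFutureTimelikeOnIcc g T γ a b) (hab : a' < b') (ha : a ≤ a') (hb : b' ≤ b) :
    IsFutureTimelikeOnIcc g T γ a' b' := by
  have hsub : Icc a' b' ⊆ Icc a b := Icc_subset_Icc ha hb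
  refine ⟨h.1.mono hsub, fun s hs ↦ ?_⟩
  rw [mfderivWithin_subset hsub (uniqueDiffOn_Icc hab s hs).uniqueMDiffWithinAt
    ((h.1 s (hsub hs)).mdifferentiableWithinAt one_ne_zero)]
  exact h.2 s (hsub hs)

theorem IsFutureTimelikeOnIcc.congr {γ γ' : ℝ → M} {a b : ℝ}
    (h : IsFutureTimelikeOnIcc g T γ a b) (heq : EqOn γ' γ (Icc a b)) :
    IsFutureTimelikeOnIcc g T γ' a b := by
  refine ⟨h.1.congr heq, fun s hs ↦ ?_⟩
  have h1 := h.2 s hs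
  have key : ∀ (x : M) (w : ℝ →L[ℝ] EuclideanSpace ℝ (Fin (n + 1))), x = γ s →
      w = mfderivWithin 𝓘(ℝ, ℝ) (𝓡 (n + 1)) γ (Icc a b) s →
      IsFutureTimelike g T x (w (1 : ℝ)) := by
    rintro x w rfl rfl
    exact h1
  exact key _ _ (heq hs) (mfderivWithin_congr heq (heq hs))

/-- Straight segments in a chart with end points close to `x` and velocity close to that of a future
timelike vector at `x` are future timelike curves. -/
theorem exists_isFutureTimelikeOnIcc_segment {x : M} {w₀ : TangentSpace (𝓡 (n + 1)) x}
    (hw₀ : IsFutureTimelike g T x w₀) :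
    ∃ Y ∈ 𝓝 (extChartAt (𝓡 (n + 1)) x x),
      ∃ W ∈ 𝓝 (mfderiv (𝓡 (n + 1)) 𝓘(ℝ, EuclideanSpace ℝ (Fin (n + 1)))
        (extChartAt (𝓡 (n + 1)) x) x w₀ : EuclideanSpace ℝ (Fin (n + 1))),
      ∀ (a b : ℝ), a < b → ∀ y₀ ∈ Y, ∀ y₁ ∈ Y, (b - a)⁻¹ • (y₁ - y₀) ∈ W →
        IsFutureTimelikeOnIcc g T
          (fun s ↦ (extChartAt (𝓡 (n + 1)) x).symm (y₀ + (s - a) • (b - a)⁻¹ • (y₁ - y₀))) a b := by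
  exact exists_nhds_segment_extChartAt_symm_mem (isOpen_setOf_isFutureTimelike g T) hw₀

end TimelikeCurves

/-! ### Broken timelike curves -/

section Broken

variable {M : Type*}

/-- The curve that follows `γ₁` up to time `a`, then `c` up to time `b`, and then `γ₂`. -/
noncomputable def brokenCurve (γ₁ c γ₂ : ℝ → M) (a b : ℝ) (t : ℝ) : M :=
  if t ≤ a then γ₁ t else if t ≤ b then c t else γ₂ t

/-- The domain of `brokenCurve`, where `γ₁` is defined on `J₁` and `γ₂` on `J₂`; written as a union
of open sets. -/
def brokenDomain (J₁ J₂ : Set ℝ) (a b : ℝ) : Set ℝ :=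
  J₁ ∩ Iio b ∪ Ioo a b ∪ J₂ ∩ Ioi a

variable {γ₁ c γ₂ : ℝ → M} {J₁ J₂ : Set ℝ} {a b t : ℝ}

theorem brokenCurve_of_le (ht : t ≤ a) : brokenCurve γ₁ c γ₂ a b t = γ₁ t := if_pos ht

theorem brokenCurve_of_mem_Icc (hca : c a = γ₁ a) (ht : t ∈ Icc a b) :
    brokenCurve γ₁ c γ₂ a b t = c t := by
  rcases ht.1.eq_or_lt with rfl | h
  · rw [brokenCurve_of_le le_rfl, hca]
  · rw [brokenCurve, if_neg h.not_ge, if_pos ht.2]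

theorem brokenCurve_of_ge (hab : a < b) (hcb : c b = γ₂ b) (ht : b ≤ t) :
    brokenCurve γ₁ c γ₂ a b t = γ₂ t := by
  rcases ht.eq_or_lt with rfl | h
  · rw [brokenCurve, if_neg hab.not_ge, if_pos le_rfl, hcb]
  · rw [brokenCurve, if_neg (hab.trans h).not_ge, if_neg h.not_ge]

theorem mem_brokenDomain_iff_of_le (hab : a < b) (ht : t ≤ a) :
    t ∈ brokenDomain J₁ J₂ a b ↔ t ∈ J₁ := by
  simp only [brokenDomain, mem_union, mem_inter_iff, mem_Iio, mem_Ioo, mem_Ioi]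
  constructor
  · rintro ((h | h) | h)
    · exact h.1
    · exact absurd h.1 ht.not_gt
    · exact absurd h.2 ht.not_gt
  · exact fun h ↦ Or.inl (Or.inl ⟨h, ht.trans_lt hab⟩)

theorem mem_brokenDomain_iff_of_ge (hab : a < b) (ht : b ≤ t) :
    t ∈ brokenDomain J₁ J₂ a b ↔ t ∈ J₂ := by
  simp only [brokenDomain, mem_union, mem_inter_iff, mem_Iio, mem_Ioo, mem_Ioi]
  constructor
  · rintro ((h | h) | h)
    · exact absurd h.2 ht.not_gt
    · exact absurd h.2 ht.not_gt
    · exact h.1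
  · exact fun h ↦ Or.inr ⟨h, hab.trans_le ht⟩

theorem ordConnected_brokenDomain (h₁ : J₁.OrdConnected) (h₂ : J₂.OrdConnected) (ha : a ∈ J₁)
    (hb : b ∈ J₂) (hab : a < b) : (brokenDomain J₁ J₂ a b).OrdConnected := by
  refine ⟨fun x hx y hy z hz ↦ ?_⟩
  rcases le_or_gt z a with h | h
  · rw [mem_brokenDomain_iff_of_le hab h]
    exact h₁.out ((mem_brokenDomain_iff_of_le hab (hz.1.trans h)).1 hx) ha ⟨hz.1, h⟩
  rcases le_or_gt b z with h' | h'
  · rw [mem_brokenDomain_iff_of_ge hab h']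
    exact h₂.out hb ((mem_brokenDomain_iff_of_ge hab (h'.trans hz.2)).1 hy) ⟨h', hz.2⟩
  · exact Or.inl (Or.inr ⟨h, h'⟩)

end Broken

section BrokenCurves

variable {n : ℕ} {k : ℕ∞} {M : Type*} [TopologicalSpace M]
  [ChartedSpace (EuclideanSpace ℝ (Fin (n + 1))) M] [IsManifold (𝓡 (n + 1)) ∞ M]
  {g : LorentzianMetric n k M} {T : TimeOrientation g}

theorem IsMIntegralCurveOn.isTimelikeCurve {X : (x : M) → TangentSpace (𝓡 (n + 1)) x}
    (hXc : Continuous (fun x ↦ (⟨x, X x⟩ : TangentBundle (𝓡 (n + 1)) M)))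
    (hX : ∀ x, IsFutureTimelike g T x (X x)) {γ : ℝ → M} {J : Set ℝ} (hJ : IsOpen J)
    (hJc : J.OrdConnected) (hJn : J.Nonempty) (hγ : IsMIntegralCurveOn γ X J) :
    IsTimelikeCurve g T γ J := by
  refine ⟨hJ, hJc, hJn, fun t ht ↦ ?_⟩
  obtain ⟨ε, hε, hεJ⟩ := Metric.nhds_basis_closedBall.mem_iff.1 (hJ.mem_nhds ht)
  rw [Real.closedBall_eq_Icc] at hεJ
  exact ⟨ε, hε, hεJ,
    hγ.isFutureTimelikeOnIcc hXc hX hJ (by linarith)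
      ((Icc_subset_Icc_right (by linarith)).trans hεJ),
    hγ.isFutureTimelikeOnIcc hXc hX hJ (by linarith)
      ((Icc_subset_Icc_left (by linarith)).trans hεJ)⟩

/-- A point `γ u` of an integral curve of a future timelike field can be joined to all points `q`
near `γ s₀` by a timelike curve, provided that `u` is close enough to `s₀`: the average velocity
needed is close to the velocity of `γ` at `s₀`. -/
theorem IsMIntegralCurveAt.eventually_exists_isFutureTimelikeOnIcc
    {X : (x : M) → TangentSpace (𝓡 (n + 1)) x} (hX : ∀ x, IsFutureTimelike g T x (X x))
    {γ : ℝ → M} {s₀ : ℝ} (hγ : IsMIntegralCurveAt γ X s₀) :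
    ∀ᶠ u in 𝓝[≠] s₀, ∀ᶠ q in 𝓝 (γ s₀), ∃ c : ℝ → M, c u = γ u ∧ c s₀ = q ∧
      (u < s₀ → IsFutureTimelikeOnIcc g T c u s₀) ∧
      (s₀ < u → IsFutureTimelikeOnIcc g T c s₀ u) := by
  obtain ⟨Y, hY, W, hW, hYW⟩ := exists_isFutureTimelikeOnIcc_segment (hX (γ s₀))
  obtain ⟨W', hW'W, hW'o, hwW'⟩ := mem_nhds_iff.1 hW
  set β : ℝ → EuclideanSpace ℝ (Fin (n + 1)) := extChartAt (𝓡 (n + 1)) (γ s₀) ∘ γ with hβ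
  have hβ' := hγ.hasDerivAt_extChartAt_comp
  have hslope := hasDerivAt_iff_tendsto_slope.1 hβ' (hW'o.mem_nhds hwW')
  have hYu : ∀ᶠ u in 𝓝[≠] s₀, β u ∈ Y :=
    mem_nhdsWithin_of_mem_nhds (hβ'.continuousAt hY)
  have hsu : ∀ᶠ u in 𝓝[≠] s₀, γ u ∈ (extChartAt (𝓡 (n + 1)) (γ s₀)).source :=
    mem_nhdsWithin_of_mem_nhds (hγ.continuousAt (extChartAt_source_mem_nhds (γ s₀)))
  filter_upwards [hslope, hYu, hsu, self_mem_nhdsWithin] with u hu hYu hsu hne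
  have hcφ := continuousAt_extChartAt (I := 𝓡 (n + 1)) (γ s₀)
  have hWq : ∀ᶠ q in 𝓝 (γ s₀),
      (u - s₀)⁻¹ • (β u - extChartAt (𝓡 (n + 1)) (γ s₀) q) ∈ W' := by
    have hc : ContinuousAt
        (fun q ↦ (u - s₀)⁻¹ • (β u - extChartAt (𝓡 (n + 1)) (γ s₀) q)) (γ s₀) :=
      by fun_prop
    refine hc.preimage_mem_nhds (hW'o.mem_nhds ?_)
    change slope β s₀ u ∈ W' at hu
    rwa [slope_def_module] at hu
  filter_upwards [hWq, hcφ hY, extChartAt_source_mem_nhds (I := 𝓡 (n + 1)) (γ s₀)]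
    with q hq hqY hqs
  rcases lt_or_gt_of_ne hne with h | h
  · refine ⟨_, ?_, ?_, fun _ ↦ hYW u s₀ h (β u) hYu _ hqY (hW'W ?_), fun h' ↦ (h.not_gt h').elim⟩
    · simp only [sub_self, zero_smul, add_zero]
      exact (extChartAt (𝓡 (n + 1)) (γ s₀)).left_inv hsu
    · rw [smul_inv_smul₀ (sub_pos.2 h).ne', add_sub_cancel]
      exact (extChartAt (𝓡 (n + 1)) (γ s₀)).left_inv hqs
    · rwa [← neg_sub u s₀, inv_neg, neg_smul, ← smul_neg, neg_sub]
  · refine ⟨_, ?_, ?_, fun h' ↦ (h.not_gt h').elim, fun _ ↦ hYW s₀ u h _ hqY (β u) hYu (hW'W hq)⟩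
    · rw [smul_inv_smul₀ (sub_pos.2 h).ne', add_sub_cancel]
      exact (extChartAt (𝓡 (n + 1)) (γ s₀)).left_inv hsu
    · simp only [sub_self, zero_smul, add_zero]
      exact (extChartAt (𝓡 (n + 1)) (γ s₀)).left_inv hqs

section BrokenCurve

variable {γ₁ c γ₂ : ℝ → M} {J₁ J₂ : Set ℝ} {a b : ℝ}

theorem IsTimelikeCurve.brokenCurve (h₁ : IsTimelikeCurve g T γ₁ J₁)
    (h₂ : IsTimelikeCurve g T γ₂ J₂) (hc : IsFutureTimelikeOnIcc g T c a b) (ha : a ∈ J₁)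
    (hb : b ∈ J₂) (hab : a < b) (hca : c a = γ₁ a) (hcb : c b = γ₂ b) :
    IsTimelikeCurve g T (brokenCurve γ₁ c γ₂ a b) (brokenDomain J₁ J₂ a b) := by
  have hopen : IsOpen (brokenDomain J₁ J₂ a b) :=
    ((h₁.isOpen.inter isOpen_Iio).union isOpen_Ioo).union (h₂.isOpen.inter isOpen_Ioi)
  refine ⟨hopen, ordConnected_brokenDomain h₁.ordConnected h₂.ordConnected ha hb hab,
    ⟨a, (mem_brokenDomain_iff_of_le hab le_rfl).2 ha⟩, fun t ht ↦ ?_⟩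
  have hleft : ∃ ε > 0, IsFutureTimelikeOnIcc g T (_root_.brokenCurve γ₁ c γ₂ a b) (t - ε) t := by
    rcases le_or_gt t a with h | h
    · obtain ⟨ε, hε, -, hl, -⟩ :=
        h₁.piecewise t ((mem_brokenDomain_iff_of_le hab h).1 ht)
      exact ⟨ε, hε, hl.congr fun s hs ↦ brokenCurve_of_le (hs.2.trans h)⟩
    rcases le_or_gt t b with h' | h'
    · refine ⟨t - a, sub_pos.2 h, ?_⟩
      rw [sub_sub_cancel]
      exact (hc.mono h le_rfl h').congr
        fun s hs ↦ brokenCurve_of_mem_Icc hca ⟨hs.1, hs.2.trans h'⟩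
    · obtain ⟨ε, hε, -, hl, -⟩ :=
        h₂.piecewise t ((mem_brokenDomain_iff_of_ge hab h'.le).1 ht)
      have hm : 0 < min ε (t - b) := lt_min hε (sub_pos.2 h')
      refine ⟨min ε (t - b), hm, (hl.mono (by linarith) ?_ le_rfl).congr
        fun s hs ↦ brokenCurve_of_ge hab hcb ?_⟩
      · linarith [min_le_left ε (t - b)]
      · linarith [min_le_right ε (t - b), hs.1]
  have hright : ∃ ε > 0, IsFutureTimelikeOnIcc g T (_root_.brokenCurve γ₁ c γ₂ a b) t (t + ε) := by
    rcases le_or_gt b t with h | h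
    · obtain ⟨ε, hε, -, -, hr⟩ :=
        h₂.piecewise t ((mem_brokenDomain_iff_of_ge hab h).1 ht)
      exact ⟨ε, hε, hr.congr fun s hs ↦ brokenCurve_of_ge hab hcb (h.trans hs.1)⟩
    rcases le_or_gt a t with h' | h'
    · refine ⟨b - t, sub_pos.2 h, ?_⟩
      rw [add_sub_cancel]
      exact (hc.mono h h' le_rfl).congr
        fun s hs ↦ brokenCurve_of_mem_Icc hca ⟨h'.trans hs.1, hs.2⟩
    · obtain ⟨ε, hε, -, -, hr⟩ :=
        h₁.piecewise t ((mem_brokenDomain_iff_of_le hab h'.le).1 ht)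
      have hm : 0 < min ε (a - t) := lt_min hε (sub_pos.2 h')
      refine ⟨min ε (a - t), hm, (hr.mono (by linarith) le_rfl ?_).congr
        fun s hs ↦ brokenCurve_of_le ?_⟩
      · linarith [min_le_left ε (a - t)]
      · linarith [min_le_right ε (a - t), hs.2]
  obtain ⟨ε, hε, hεJ⟩ := Metric.nhds_basis_closedBall.mem_iff.1 (hopen.mem_nhds ht)
  rw [Real.closedBall_eq_Icc] at hεJ
  obtain ⟨ε₁, hε₁, hl⟩ := hleft
  obtain ⟨ε₂, hε₂, hr⟩ := hright
  have hm : 0 < min ε (min ε₁ ε₂) := lt_min hε (lt_min hε₁ hε₂)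
  have hm0 : min ε (min ε₁ ε₂) ≤ ε := min_le_left _ _
  have hm1 : min ε (min ε₁ ε₂) ≤ ε₁ := (min_le_right _ _).trans (min_le_left _ _)
  have hm2 : min ε (min ε₁ ε₂) ≤ ε₂ := (min_le_right _ _).trans (min_le_right _ _)
  exact ⟨min ε (min ε₁ ε₂), hm, (Icc_subset_Icc (by linarith) (by linarith)).trans hεJ,
    hl.mono (by linarith) (by linarith) le_rfl, hr.mono (by linarith) le_rfl (by linarith)⟩

theorem IsInextendible.brokenCurve (h₁ : IsInextendible γ₁ J₁) (h₂ : IsInextendible γ₂ J₂)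
    (ha : a ∈ J₁) (hb : b ∈ J₂) (hab : a < b) (hcb : c b = γ₂ b) :
    IsInextendible (brokenCurve γ₁ c γ₂ a b) (brokenDomain J₁ J₂ a b) := by
  have : Nonempty J₁ := ⟨⟨a, ha⟩⟩
  have : Nonempty J₂ := ⟨⟨b, hb⟩⟩
  have : Nonempty (brokenDomain J₁ J₂ a b) := ⟨⟨a, (mem_brokenDomain_iff_of_le hab le_rfl).2 ha⟩⟩
  refine ⟨fun p hp ↦ h₂.1 p ?_, fun p hp ↦ h₁.2 p ?_⟩
  · rw [tendsto_atTop'] at hp ⊢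
    intro s hs
    obtain ⟨t₀, ht₀⟩ := hp s hs
    have hmem : max b t₀ ∈ brokenDomain J₁ J₂ a b := by
      rcases le_total b t₀ with h | h
      · rw [max_eq_right h]
        exact t₀.2
      · rw [max_eq_left h]
        exact (mem_brokenDomain_iff_of_ge hab le_rfl).2 hb
    refine ⟨⟨max b t₀, (mem_brokenDomain_iff_of_ge hab (le_max_left _ _)).1 hmem⟩, fun t ht ↦ ?_⟩
    have ht1 : max b t₀ ≤ (t : ℝ) := ht
    have htb : b ≤ (t : ℝ) := (le_max_left _ _).trans ht1
    have h := ht₀ ⟨t, (mem_brokenDomain_iff_of_ge hab htb).2 t.2⟩ ((le_max_right b _).trans ht1)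
    rwa [brokenCurve_of_ge hab hcb htb] at h
  · rw [tendsto_atBot'] at hp ⊢
    intro s hs
    obtain ⟨t₀, ht₀⟩ := hp s hs
    have hmem : min a t₀ ∈ brokenDomain J₁ J₂ a b := by
      rcases le_total a t₀ with h | h
      · rw [min_eq_left h]
        exact (mem_brokenDomain_iff_of_le hab le_rfl).2 ha
      · rw [min_eq_right h]
        exact t₀.2
    refine ⟨⟨min a t₀, (mem_brokenDomain_iff_of_le hab (min_le_left _ _)).1 hmem⟩, fun t ht ↦ ?_⟩
    have ht1 : (t : ℝ) ≤ min a t₀ := ht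
    have hta : (t : ℝ) ≤ a := ht1.trans (min_le_left _ _)
    have h := ht₀ ⟨t, (mem_brokenDomain_iff_of_le hab hta).2 t.2⟩ (ht1.trans (min_le_right a _))
    rwa [brokenCurve_of_le hta] at h

end BrokenCurve

end BrokenCurves

/-! ### Projection onto a Cauchy hypersurface along the flow -/

section CauchyProjection

variable {n : ℕ} {k : ℕ∞} {M : Type*} [TopologicalSpace M]
  [ChartedSpace (EuclideanSpace ℝ (Fin (n + 1))) M] [IsManifold (𝓡 (n + 1)) ∞ M]
  {X : (x : M) → TangentSpace (𝓡 (n + 1)) x} {g : LorentzianMetric n k M} {T : TimeOrientation g}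
  {H : Set M}
  [T2Space M]

theorem isTimelikeCurve_flow
    (hXs : ContMDiff (𝓡 (n + 1)) (𝓡 (n + 1)).tangent 1
      (fun x ↦ (⟨x, X x⟩ : TangentBundle (𝓡 (n + 1)) M)))
    (hX : ∀ x, IsFutureTimelike g T x (X x)) (p : M) :
    IsTimelikeCurve g T (flow X p) (flowDomain X p) :=
  (isMIntegralCurveOn_flow hXs p).isTimelikeCurve hXs.continuous hX (isOpen_flowDomain p)
    (ordConnected_flowDomain p) ⟨0, zero_mem_flowDomain hXs p⟩

theorem IsCauchyHypersurface.existsUnique_flow (hH : IsCauchyHypersurface g T H)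
    (hXs : ContMDiff (𝓡 (n + 1)) (𝓡 (n + 1)).tangent 1
      (fun x ↦ (⟨x, X x⟩ : TangentBundle (𝓡 (n + 1)) M)))
    (hX : ∀ x, IsFutureTimelike g T x (X x)) (p : M) :
    ∃! t : ℝ, t ∈ flowDomain X p ∧ flow X p t ∈ H :=
  hH _ _ (isTimelikeCurve_flow hXs hX p) (isInextendible_flow hXs (fun x ↦ (hX x).ne_zero) p)

/-- If the past flow line of `p` meets `H`, then the future flow lines of the points near `p` do
not: the former can be joined to the latter by a short segment, and the resulting curve is timelike
and meets `H` once only. -/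
theorem IsCauchyHypersurface.eventually_flow_notMem_of_neg (hH : IsCauchyHypersurface g T H)
    (hXs : ContMDiff (𝓡 (n + 1)) (𝓡 (n + 1)).tangent 1
      (fun x ↦ (⟨x, X x⟩ : TangentBundle (𝓡 (n + 1)) M)))
    (hX : ∀ x, IsFutureTimelike g T x (X x)) {p : M} {s : ℝ} (hs : s < 0)
    (hsp : s ∈ flowDomain X p) (hsH : flow X p s ∈ H) :
    ∀ᶠ q in 𝓝 p, ∀ t ∈ flowDomain X q, 0 ≤ t → flow X q t ∉ H := by
  have h0 := zero_mem_flowDomain hXs p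
  have hpush := ((isMIntegralCurveOn_flow hXs p).isMIntegralCurveAt
    ((isOpen_flowDomain p).mem_nhds h0)).eventually_exists_isFutureTimelikeOnIcc hX
  obtain ⟨u, hu, hsu, hu0⟩ : ∃ u, (∀ᶠ q in 𝓝 (flow X p 0), ∃ c : ℝ → M, c u = flow X p u ∧
      c 0 = q ∧ (u < 0 → IsFutureTimelikeOnIcc g T c u 0) ∧
      (0 < u → IsFutureTimelikeOnIcc g T c 0 u)) ∧ s < u ∧ u < 0 := by
    have h1 := hpush.filter_mono (nhdsLT_le_nhdsNE (0 : ℝ))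
    have h2 : ∀ᶠ u in 𝓝[<] (0 : ℝ), u ∈ Ioo s 0 := Ioo_mem_nhdsLT hs
    obtain ⟨u, hu, hu'⟩ := (h1.and h2).exists
    exact ⟨u, hu, hu'⟩
  have hup : u ∈ flowDomain X p := (ordConnected_flowDomain p).out hsp h0 ⟨hsu.le, hu0.le⟩
  rw [flow_zero hXs] at hu
  filter_upwards [hu] with q ⟨c, hcu, hc0, hc, _⟩ t ht ht0 htH
  have hq0 := zero_mem_flowDomain hXs q
  have hcq : c 0 = flow X q 0 := by rw [hc0, flow_zero hXs]
  have hcurve := (isTimelikeCurve_flow hXs hX p).brokenCurve (isTimelikeCurve_flow hXs hX q)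
    (hc hu0) hup hq0 hu0 hcu hcq
  have hinext := (isInextendible_flow hXs (fun x ↦ (hX x).ne_zero) p).brokenCurve
    (isInextendible_flow hXs (fun x ↦ (hX x).ne_zero) q) hup hq0 hu0 hcq
  have heq := (hH _ _ hcurve hinext).unique (y₁ := s) (y₂ := t)
    ⟨(mem_brokenDomain_iff_of_le hu0 hsu.le).2 hsp, by rwa [brokenCurve_of_le hsu.le]⟩
    ⟨(mem_brokenDomain_iff_of_ge hu0 ht0).2 ht, by rwa [brokenCurve_of_ge hu0 hcq ht0]⟩
  linarith

/-- If the future flow line of `p` meets `H`, then the past flow lines of the points near `p` do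
not. -/
theorem IsCauchyHypersurface.eventually_flow_notMem_of_pos (hH : IsCauchyHypersurface g T H)
    (hXs : ContMDiff (𝓡 (n + 1)) (𝓡 (n + 1)).tangent 1
      (fun x ↦ (⟨x, X x⟩ : TangentBundle (𝓡 (n + 1)) M)))
    (hX : ∀ x, IsFutureTimelike g T x (X x)) {p : M} {s : ℝ} (hs : 0 < s)
    (hsp : s ∈ flowDomain X p) (hsH : flow X p s ∈ H) :
    ∀ᶠ q in 𝓝 p, ∀ t ∈ flowDomain X q, t ≤ 0 → flow X q t ∉ H := by
  have h0 := zero_mem_flowDomain hXs p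
  have hpush := ((isMIntegralCurveOn_flow hXs p).isMIntegralCurveAt
    ((isOpen_flowDomain p).mem_nhds h0)).eventually_exists_isFutureTimelikeOnIcc hX
  obtain ⟨u, hu, hu0, hus⟩ : ∃ u, (∀ᶠ q in 𝓝 (flow X p 0), ∃ c : ℝ → M, c u = flow X p u ∧
      c 0 = q ∧ (u < 0 → IsFutureTimelikeOnIcc g T c u 0) ∧
      (0 < u → IsFutureTimelikeOnIcc g T c 0 u)) ∧ 0 < u ∧ u < s := by
    have h1 := hpush.filter_mono (nhdsGT_le_nhdsNE (0 : ℝ))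
    have h2 : ∀ᶠ u in 𝓝[>] (0 : ℝ), u ∈ Ioo 0 s := Ioo_mem_nhdsGT hs
    obtain ⟨u, hu, hu'⟩ := (h1.and h2).exists
    exact ⟨u, hu, hu'⟩
  have hup : u ∈ flowDomain X p := (ordConnected_flowDomain p).out h0 hsp ⟨hu0.le, hus.le⟩
  rw [flow_zero hXs] at hu
  filter_upwards [hu] with q ⟨c, hcu, hc0, _, hc⟩ t ht ht0 htH
  have hq0 := zero_mem_flowDomain hXs q
  have hcq : c 0 = flow X q 0 := by rw [hc0, flow_zero hXs]
  have hcurve := (isTimelikeCurve_flow hXs hX q).brokenCurve (isTimelikeCurve_flow hXs hX p)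
    (hc hu0) hq0 hup hu0 hcq hcu
  have hinext := (isInextendible_flow hXs (fun x ↦ (hX x).ne_zero) q).brokenCurve
    (isInextendible_flow hXs (fun x ↦ (hX x).ne_zero) p) hq0 hup hu0 hcu
  have heq := (hH _ _ hcurve hinext).unique (y₁ := t) (y₂ := s)
    ⟨(mem_brokenDomain_iff_of_le hu0 ht0).2 ht, by rwa [brokenCurve_of_le ht0]⟩
    ⟨(mem_brokenDomain_iff_of_ge hu0 hus.le).2 hsp, by rwa [brokenCurve_of_ge hu0 hcu hus.le]⟩
  linarith

/-- The projection onto a Cauchy hypersurface along the flow lines of a future timelike vector field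
exists and is continuous. -/
theorem IsCauchyHypersurface.exists_continuous_projection (hH : IsCauchyHypersurface g T H)
    (hXs : ContMDiff (𝓡 (n + 1)) (𝓡 (n + 1)).tangent 1
      (fun x ↦ (⟨x, X x⟩ : TangentBundle (𝓡 (n + 1)) M)))
    (hX : ∀ x, IsFutureTimelike g T x (X x)) :
    ∃ ρ : M → M, Continuous ρ ∧ (∀ p, ρ p ∈ H) ∧ (∀ h ∈ H, ρ h = h) ∧
      (∀ p, ∀ t ∈ flowDomain X p, ρ (flow X p t) = ρ p) ∧
      ∀ p, ∃ t ∈ flowDomain X p, flow X p t = ρ p := by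
  choose τ hτ hτu using hH.existsUnique_flow hXs hX
  have hflow : ∀ p, ∀ t ∈ flowDomain X p, flow X (flow X p t) (τ (flow X p t)) =
      flow X p (τ p) := by
    intro p t ht
    obtain ⟨h1, h2⟩ := hτ (flow X p t)
    have h3 := (add_mem_flowDomain_iff hXs ht).2 h1
    have h4 := flow_add hXs ht h1
    rw [← hτu p (t + τ (flow X p t)) ⟨h3, by rwa [h4]⟩, h4]
  have hid : ∀ h ∈ H, flow X h (τ h) = h := by
    intro h hh
    rw [← hτu h 0 ⟨zero_mem_flowDomain hXs h, by rwa [flow_zero hXs]⟩, flow_zero hXs]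
  refine ⟨fun p ↦ flow X p (τ p), ?_, fun p ↦ (hτ p).2, hid, hflow,
    fun p ↦ ⟨τ p, (hτ p).1, rfl⟩⟩
  -- continuity at the points of `H`: the flow times `τ q` of points `q` near `h` are small
  have hcontH : ∀ h ∈ H, ∀ V ∈ 𝓝 h, ∀ᶠ q in 𝓝 h, flow X q (τ q) ∈ V := by
    intro h hh V hV
    obtain ⟨U, hU, hhU, ε, hε, hdom, hc⟩ := exists_continuousOn_flow hXs h
    have h0 : (0 : ℝ) ∈ Ioo (-ε) ε := ⟨by linarith, hε⟩
    have hc0 := hc.continuousAt (x := (h, 0))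
      (prod_mem_nhds (hU.mem_nhds hhU) (Ioo_mem_nhds h0.1 h0.2))
    have hV' : V ∈ 𝓝 (flow X h 0) := by rwa [flow_zero hXs]
    obtain ⟨U', hU', S, hS, hUS⟩ := mem_nhds_prod_iff.1 (hc0.preimage_mem_nhds hV')
    obtain ⟨δ, hδ, hδS⟩ := Metric.mem_nhds_iff.1 hS
    rw [Real.ball_eq_Ioo, zero_sub, zero_add] at hδS
    set s := min ε δ / 2 with hs_def
    have hs : 0 < s := half_pos (lt_min hε hδ)
    have hsε : s < ε := by linarith [min_le_left ε δ]
    have hsδ : s < δ := by linarith [min_le_right ε δ]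
    have hs1 : s ∈ Ioo (-ε) ε := ⟨by linarith, hsε⟩
    have hs2 : -s ∈ Ioo (-ε) ε := ⟨by linarith, by linarith⟩
    have hflowc : ∀ t ∈ Ioo (-ε) ε, ContinuousAt (fun q ↦ flow X q t) h := fun t ht ↦
      ContinuousAt.comp (f := fun q : M ↦ (q, t)) (g := fun z : M × ℝ ↦ flow X z.1 z.2)
        (hc.continuousAt (prod_mem_nhds (hU.mem_nhds hhU) (Ioo_mem_nhds ht.1 ht.2)))
        (by fun_prop)
    have hback1 := neg_mem_flowDomain hXs (hdom h hhU hs1)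
    have hback2 := neg_mem_flowDomain hXs (hdom h hhU hs2)
    have hfut := hH.eventually_flow_notMem_of_neg hXs hX (neg_lt_zero.2 hs) hback1.1
      (by rwa [hback1.2])
    have hpast := hH.eventually_flow_notMem_of_pos hXs hX (neg_pos.2 (neg_lt_zero.2 hs)) hback2.1
      (by rwa [hback2.2])
    filter_upwards [(hflowc s hs1).eventually hfut, (hflowc (-s) hs2).eventually hpast, hU',
      hU.mem_nhds hhU] with q hq1 hq2 hqU' hqU
    obtain ⟨hτd, hτH⟩ := hτ q
    refine hUS (mk_mem_prod hqU' (hδS ⟨?_, ?_⟩))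
    · by_contra! hlt
      have hd : τ q + s ∈ flowDomain X (flow X q (-s)) := by
        rw [← add_mem_flowDomain_iff hXs (hdom q hqU hs2), neg_add_cancel_comm_assoc]
        exact hτd
      refine hq2 _ hd (by linarith) ?_
      rw [← flow_add hXs (hdom q hqU hs2) hd, neg_add_cancel_comm_assoc]
      exact hτH
    · by_contra! hlt
      have hd : τ q - s ∈ flowDomain X (flow X q s) := by
        rw [← add_mem_flowDomain_iff hXs (hdom q hqU hs1), add_sub_cancel]
        exact hτd
      refine hq1 _ hd (by linarith) ?_
      rw [← flow_add hXs (hdom q hqU hs1) hd, add_sub_cancel]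
      exact hτH
  -- continuity elsewhere, by transport along the flow lines
  rw [continuous_iff_continuousAt]
  intro p V hV
  obtain ⟨h1, h2⟩ := hτ p
  refine mem_nhds_of_mem_nhds_flow hXs (fun q t ht hq ↦ ?_) h1 (hcontH _ h2 V hV)
  have hq' : flow X (flow X q t) (τ (flow X q t)) ∈ V := hq
  rwa [hflow q t ht] at hq'

/-- A future timelike vector field is transverse to a spacelike hypersurface `S`, so that all flow
lines that start near a point of `S` meet `S`. -/
theorem IsSpacelikeHypersurface.eventually_exists_flow_mem {S : Set M}
    (hS : IsSpacelikeHypersurface g S)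
    (hXs : ContMDiff (𝓡 (n + 1)) (𝓡 (n + 1)).tangent 1
      (fun x ↦ (⟨x, X x⟩ : TangentBundle (𝓡 (n + 1)) M)))
    (hX : ∀ x, IsFutureTimelike g T x (X x)) {s : M} (hs : s ∈ S) :
    ∀ᶠ q in 𝓝 s, ∃ t ∈ flowDomain X q, flow X q t ∈ S := by
  obtain ⟨U, f, hsU, hf⟩ := hS.isHypersurface s hs
  have hfX : mfderiv (𝓡 (n + 1)) 𝓘(ℝ, ℝ) f s (X s) ≠ 0 := fun h ↦
    (hS.isSpacelike U f hf s ⟨hs, hsU⟩ (X s) (hX s).ne_zero h).not_gt (hX s).1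
  have hfs : f s = 0 := (hf.inter_eq.subset ⟨hs, hsU⟩).2
  obtain ⟨W, hW, hsW, ε, hε, hdom, hc⟩ := exists_continuousOn_flow hXs s
  have h0 : (0 : ℝ) ∈ Ioo (-ε) ε := ⟨by linarith, hε⟩
  have hc0 := hc.continuousAt (x := (s, 0))
    (prod_mem_nhds (hW.mem_nhds hsW) (Ioo_mem_nhds h0.1 h0.2))
  have hU' : U ∈ 𝓝 (flow X s 0) := by
    rw [flow_zero hXs]
    exact hf.isOpen.mem_nhds hsU
  -- a flow box that stays in `U`
  obtain ⟨W', hW', S', hS', hWS⟩ := mem_nhds_prod_iff.1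
    (inter_mem (hc0.preimage_mem_nhds hU')
      (prod_mem_nhds (hW.mem_nhds hsW) (Ioo_mem_nhds h0.1 h0.2)))
  obtain ⟨δ, hδ, hδS⟩ := Metric.mem_nhds_iff.1 hS'
  rw [Real.ball_eq_Ioo, zero_sub, zero_add] at hδS
  have hfc : ContinuousOn (fun z : M × ℝ ↦ f (flow X z.1 z.2)) (W' ×ˢ Ioo (-δ) δ) := by
    refine hf.contMDiffOn.continuousOn.comp (hc.mono ?_) ?_
    · exact fun z hz ↦ (hWS (mk_mem_prod hz.1 (hδS hz.2))).2
    · exact fun z hz ↦ (hWS (mk_mem_prod hz.1 (hδS hz.2))).1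
  have hder : HasDerivAt (f ∘ flow X s) (mfderiv (𝓡 (n + 1)) 𝓘(ℝ, ℝ) f s (X s) : ℝ) 0 := by
    have h1 := (isMIntegralCurveOn_flow hXs s 0 (zero_mem_flowDomain hXs s)).hasMFDerivAt
      ((isOpen_flowDomain s).mem_nhds (zero_mem_flowDomain hXs s))
    have h2 : HasMFDerivAt (𝓡 (n + 1)) 𝓘(ℝ, ℝ) f (flow X s 0)
        (mfderiv (𝓡 (n + 1)) 𝓘(ℝ, ℝ) f (flow X s 0)) := by
      rw [flow_zero hXs]
      exact ((hf.contMDiffOn.contMDiffAt (hf.isOpen.mem_nhds hsU)).mdifferentiableAt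
        one_ne_zero).hasMFDerivAt
    let L : EuclideanSpace ℝ (Fin (n + 1)) →L[ℝ] ℝ :=
      mfderiv (𝓡 (n + 1)) 𝓘(ℝ, ℝ) f (flow X s 0)
    let w : EuclideanSpace ℝ (Fin (n + 1)) := X (flow X s 0)
    have h3 : HasFDerivAt (f ∘ flow X s) (L.comp ((1 : ℝ →L[ℝ] ℝ).smulRight w)) 0 :=
      hasMFDerivAt_iff_hasFDerivAt.1 (h2.comp 0 h1)
    refine h3.hasDerivAt.congr_deriv ?_
    change mfderiv (𝓡 (n + 1)) 𝓘(ℝ, ℝ) f (flow X s 0) ((1 : ℝ) • X (flow X s 0)) = _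
    rw [one_smul, flow_zero hXs]
  -- the defining function changes sign along the flow line of `s`
  have hsub : ∀ᶠ t in 𝓝 (0 : ℝ), t ∈ Ioo (-δ) δ := Ioo_mem_nhds (by linarith) hδ
  have hval0 : (f ∘ flow X s) 0 = 0 := by simp [flow_zero hXs, hfs]
  obtain ⟨t₁, ht₁, hft₁⟩ : ∃ t ∈ Ioo (-δ) δ, f (flow X s t) < 0 := by
    by_contra! hcon
    refine hfX (IsLocalMin.hasDerivAt_eq_zero ?_ hder)
    filter_upwards [hsub] with t ht
    rw [hval0]
    exact hcon t ht
  obtain ⟨t₂, ht₂, hft₂⟩ : ∃ t ∈ Ioo (-δ) δ, 0 < f (flow X s t) := by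
    by_contra! hcon
    refine hfX (IsLocalMax.hasDerivAt_eq_zero ?_ hder)
    filter_upwards [hsub] with t ht
    rw [hval0]
    exact hcon t ht
  have hcq : ∀ t ∈ Ioo (-δ) δ, ContinuousAt (fun q ↦ f (flow X q t)) s := fun t ht ↦
    ContinuousAt.comp (f := fun q : M ↦ (q, t)) (g := fun z : M × ℝ ↦ f (flow X z.1 z.2))
      (hfc.continuousAt (prod_mem_nhds hW' (Ioo_mem_nhds ht.1 ht.2))) (by fun_prop)
  -- so it does along nearby flow lines
  filter_upwards [(hcq t₁ ht₁).eventually (gt_mem_nhds hft₁),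
    (hcq t₂ ht₂).eventually (lt_mem_nhds hft₂), hW'] with q hq₁ hq₂ hqW
  have hivt := isPreconnected_Ioo.intermediate_value ht₁ ht₂
    (f := fun t ↦ f (flow X q t)) (hfc.comp (by fun_prop) fun t ht ↦ mk_mem_prod hqW ht)
  obtain ⟨t, ht, hft⟩ := hivt ⟨hq₁.le, hq₂.le⟩
  have hmem := hWS (mk_mem_prod hqW (hδS ht))
  exact ⟨t, hdom q hmem.2.1 hmem.2.2, (hf.inter_eq.superset ⟨hmem.1, hft⟩).1⟩

end CauchyProjection

/-- Every spacetime that admits a non-compact Cauchy hypersurface is spatially open. -/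
theorem mainTheorem7 {n : ℕ} {k : ℕ∞} {M : Type*} [TopologicalSpace M] [T2Space M]
    [SecondCountableTopology M] [ConnectedSpace M]
    [ChartedSpace (EuclideanSpace ℝ (Fin (n + 1))) M] [IsManifold (𝓡 (n + 1)) ∞ M]
    (g : LorentzianMetric n k M) (T : TimeOrientation g)
    (hM : ∃ H : Set M, IsCauchyHypersurface g T H ∧ ¬ IsCompact H) :
    IsSpatiallyOpen g := by
  obtain ⟨H, hH, hHc⟩ := hM
  rintro ⟨S, hSc, hS⟩
  refine hHc ?_
  have : LocallyCompactSpace M :=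
    ChartedSpace.locallyCompactSpace (EuclideanSpace ℝ (Fin (n + 1))) M
  obtain ⟨X, hXs, hX⟩ := exists_contMDiff_isFutureTimelike g T
  obtain ⟨ρ, hρc, hρH, hρid, hρflow, hρ⟩ := hH.exists_continuous_projection hXs hX
  -- the flow lines that meet `S` fill a closed and open set
  set A : Set M := ρ ⁻¹' (ρ '' S) with hA
  have hAclosed : IsClosed A := (hSc.image hρc).isClosed.preimage hρc
  have hAsat : ∀ q, ∀ t ∈ flowDomain X q, flow X q t ∈ A → q ∈ A := by
    intro q t ht hq
    rwa [hA, mem_preimage, hρflow q t ht] at hq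
  have hAS : ∀ s ∈ S, A ∈ 𝓝 s := by
    intro s hs
    filter_upwards [hS.eventually_exists_flow_mem hXs hX hs] with q ⟨t, ht, hqt⟩
    exact ⟨_, hqt, hρflow q t ht⟩
  have hAopen : IsOpen A := by
    refine isOpen_iff_mem_nhds.2 fun p ⟨s, hs, hsp⟩ ↦ ?_
    obtain ⟨t, ht, hpt⟩ := hρ p
    obtain ⟨u, hu, hsu⟩ := hρ s
    obtain ⟨hu', hsu'⟩ := neg_mem_flowDomain hXs hu
    rw [hsu] at hu' hsu'
    have h1 : A ∈ 𝓝 (ρ p) := by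
      rw [← hsp]
      exact mem_nhds_of_mem_nhds_flow hXs hAsat hu' (by rw [hsu']; exact hAS s hs)
    exact mem_nhds_of_mem_nhds_flow hXs hAsat ht (by rwa [hpt])
  have hAuniv : A = univ := by
    refine IsClopen.eq_univ ⟨hAclosed, hAopen⟩ ?_
    obtain ⟨s, hs⟩ := hS.nonempty
    exact ⟨s, s, hs, rfl⟩
  have hHS : H = ρ '' S := by
    refine Subset.antisymm (fun h hh ↦ ?_) (by rintro _ ⟨s, -, rfl⟩; exact hρH s)
    have hhA : h ∈ A := by
      rw [hAuniv]
      trivial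
    rwa [hA, mem_preimage, hρid h hh] at hhA
  rw [hHS]
  exact hSc.image hρc
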